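/- Graphs are in the sense of Serre: a graph $\Gamma=(V,E)$ has origin and terminus maps $o,t:E\to V$ and a fixed-point-free involution $e\mapsto\bar e$ of $E$ with $o(\bar e)=t(e)$ and $t(\bar e)=o(e)$. The group $\mathrm{Aut}(\Gamma)$ carries the permutation topology for its action on $V\sqcup E$ (basic open sets prescribe the images of finitely many vertices and edges). For $H\le\mathrm{Aut}(\Gamma)$ and $x\in V$, the stabilizer $H_x$ induces a permutation group on $E(x)=\{e\in E\mid o(e)=x\}$; $H$ is *locally semiprimitive* (resp. *locally primitive*) if for every $x\in V$ this permutation group is semiprimitive (resp. primitive), where a permutation group is *semiprimitive* if it is transitive and each of its normal subgroups is transitive or semiregular (has trivial point stabilizers). For a topological group $G$ let $G^{(\infty)}$ be the intersection of all closed cocompact normal subgroups of $G$, and let $\mathrm{QZ}(G)=\{g\in G\mid Z_G(g)\text{ is open in }G\}$ be its quasi-center. A topological group is *topologically simple* if it is non-trivial and has no closed normal subgroups other than the trivial subgroup and itself. **Theorem.** Let $\Gamma$ be a locally finite, connected graph, and let $H\le\mathrm{Aut}(\Gamma)$ be closed, non-discrete and locally semiprimitive. Then (i) $H^{(\infty)}$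 is minimal among the closed normal cocompact subgroups of $H$; (ii) $\mathrm{QZ}(H)$ is maximal among the discrete normal subgroups of $H$, and it is not cocompact in $H$; (iii) $\mathrm{QZ}(H^{(\infty)})=\mathrm{QZ}(H)\cap H^{(\infty)}$, and the group $H^{(\infty)}/\mathrm{QZ}(H^{(\infty)})$ admits minimal non-trivial closed normal subgroups; they are finite in number, pairwise conjugate under $H$ (acting by conjugation), and topologically simple. If, in addition, $\Gamma$ is a tree and $H$ is locally primitive, then (iv) $H^{(\infty)}/\mathrm{QZ}(H^{(\infty)})$ is, as a topological group, a direct product of finitely many topologically simple groups. -/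

import Mathlib

open scoped Pointwise

universe u v

/-! Permutation groups -/

/-- The permutation topology on a group `G` acting on a set `X`: it is generated by the sets
`{g | g • x = y}`, whose finite intersections are the basic open sets. -/
@[reducible] def permutationTopology (G : Type u) (X : Type v) [Group G] [MulAction G X] :
    TopologicalSpace G :=
  TopologicalSpace.generateFrom {U | ∃ x y : X, U = {g : G | g • x = y}}

theorem permutationTopology_isTopologicalGroup (G : Type u) (X : Type v) [Group G]
    [MulAction G X] : @IsTopologicalGroup G (permutationTopology G X) _ := by
  let _ := permutationTopology G X
  have hopen : ∀ x y : X, IsOpen {g : G | g • x = y} := fun x y =>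
    TopologicalSpace.isOpen_generateFrom_of_mem ⟨x, y, rfl⟩
  have hmul : Continuous fun p : G × G => p.1 * p.2 := by
    refine continuous_generateFrom_iff.2 ?_
    rintro _ ⟨x, y, rfl⟩
    have : (fun p : G × G => p.1 * p.2) ⁻¹' {g : G | g • x = y} =
        ⋃ z : X, {g : G | g • z = y} ×ˢ {g : G | g • x = z} := by
      ext ⟨a, b⟩
      simp [mul_smul]
    rw [this]
    exact isOpen_iUnion fun z => (hopen z y).prod (hopen x z)
  have hinv : Continuous fun g : G => g⁻¹ := by
    refine continuous_generateFrom_iff.2 ?_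
    rintro _ ⟨x, y, rfl⟩
    have : (fun g : G => g⁻¹) ⁻¹' {g : G | g • x = y} = {g : G | g • y = x} := by
      ext a
      change a⁻¹ • x = y ↔ a • y = x
      rw [inv_smul_eq_iff, eq_comm]
    rw [this]
    exact hopen y x
  exact { continuous_mul := hmul, continuous_inv := hinv }

/-- A permutation group is semiprimitive if it is transitive and each of its normal subgroups is
transitive or semiregular (all point stabilizers are trivial). -/
def IsSemiprimitive {Ω : Type u} (F : Subgroup (Equiv.Perm Ω)) : Prop :=
  MulAction.IsPretransitive F Ω ∧
    ∀ N : Subgroup F, N.Normal →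
      MulAction.IsPretransitive N Ω ∨ ∀ ω : Ω, MulAction.stabilizer N ω = ⊥

/-! Graphs in the sense of Serre -/

/-- A graph with vertex set `V` and edge set `E`: origin and terminus maps, and a fixed-point-free
involution of `E` exchanging them. -/
structure SerreGraph (V : Type u) (E : Type v) where
  o : E → V
  t : E → V
  bar : E → E
  bar_bar : ∀ e, bar (bar e) = e
  bar_ne : ∀ e, bar e ≠ e
  o_bar : ∀ e, o (bar e) = t e
  t_bar : ∀ e, t (bar e) = o e

namespace SerreGraph

variable {V : Type u} {E : Type v} (Γ : SerreGraph V E)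

/-- The set `E(x)` of edges issuing from `x`. -/
def star (x : V) : Set E := {e | Γ.o e = x}

/-- Every vertex has finite valency. -/
def IsLocallyFinite : Prop := ∀ x : V, (Γ.star x).Finite

/-- Any two vertices are joined by a path. -/
def IsConnected : Prop :=
  ∀ x y : V, Relation.ReflTransGen (fun a b => ∃ e, Γ.o e = a ∧ Γ.t e = b) x y

/-- A list of edges is a non-backtracking path if each edge starts where the previous one ends and
is not its inverse. -/
def IsNonBacktrackingPath (p : List E) : Prop :=
  p.IsChain fun e f => Γ.t e = Γ.o f ∧ f ≠ Γ.bar e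

/-- There are no closed non-backtracking paths of positive length. -/
def IsForest : Prop :=
  ∀ (p : List E) (hp : p ≠ []), Γ.IsNonBacktrackingPath p →
    Γ.o (p.head hp) ≠ Γ.t (p.getLast hp)

def IsTree : Prop := Γ.IsConnected ∧ Γ.IsForest

/-- The pairs of permutations of `V` and `E` that preserve the graph structure. -/
def autSubgroup : Subgroup (Equiv.Perm V × Equiv.Perm E) where
  carrier := {g | (∀ e, g.1 (Γ.o e) = Γ.o (g.2 e)) ∧ (∀ e, g.1 (Γ.t e) = Γ.t (g.2 e)) ∧
    ∀ e, g.2 (Γ.bar e) = Γ.bar (g.2 e)}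
  one_mem' := by simp
  mul_mem' := by
    rintro a b ⟨h1, h2, h3⟩ ⟨k1, k2, k3⟩
    simp [h1, h2, h3, k1, k2, k3]
  inv_mem' := by
    rintro a ⟨h1, h2, h3⟩
    refine ⟨fun e => ?_, fun e => ?_, fun e => ?_⟩
    · exact a.1.symm_apply_eq.2 (by rw [h1]; exact congrArg Γ.o (a.2.apply_symm_apply e).symm)
    · exact a.1.symm_apply_eq.2 (by rw [h2]; exact congrArg Γ.t (a.2.apply_symm_apply e).symm)
    · exact a.2.symm_apply_eq.2 (by rw [h3]; exact congrArg Γ.bar (a.2.apply_symm_apply e).symm)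

/-- The automorphism group of `Γ`. -/
def Aut : Type (max u v) := Γ.autSubgroup

instance : Group Γ.Aut := inferInstanceAs (Group Γ.autSubgroup)

instance : MulAction Γ.Aut V where
  smul g x := g.1.1 x
  one_smul _ := rfl
  mul_smul _ _ _ := rfl

instance : MulAction Γ.Aut E where
  smul g e := g.1.2 e
  one_smul _ := rfl
  mul_smul _ _ _ := rfl

/-- The automorphism group carries the permutation topology for its action on the disjoint union
of the vertex set and the edge set. -/
instance : TopologicalSpace Γ.Aut := permutationTopology Γ.Aut (V ⊕ E)

instance : IsTopologicalGroup Γ.Aut := permutationTopology_isTopologicalGroup Γ.Aut (V ⊕ E)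

variable {Γ}

/-- The permutation group that the stabilizer of `x` in `H` induces on `E(x)`. -/
def localAction (H : Subgroup Γ.Aut) (x : V) : Subgroup (Equiv.Perm (Γ.star x)) where
  carrier := {σ | ∃ h ∈ H, h • x = x ∧ ∀ e : Γ.star x, (σ e : E) = h • (e : E)}
  one_mem' := ⟨1, H.one_mem, one_smul _ _, fun e => (one_smul _ (e : E)).symm⟩
  mul_mem' := by
    rintro a b ⟨g, hg, hgx, hga⟩ ⟨h, hh, hhx, hhb⟩
    refine ⟨g * h, H.mul_mem hg hh, by rw [mul_smul, hhx, hgx], fun e => ?_⟩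
    rw [mul_smul, ← hhb, ← hga]
    rfl
  inv_mem' := by
    rintro a ⟨g, hg, hgx, hga⟩
    refine ⟨g⁻¹, H.inv_mem hg, by rw [inv_smul_eq_iff, hgx], fun e => ?_⟩
    rw [eq_inv_smul_iff, ← hga]
    exact congrArg Subtype.val (a.apply_symm_apply e)

def IsLocallySemiprimitive (H : Subgroup Γ.Aut) : Prop :=
  ∀ x : V, IsSemiprimitive (localAction H x)

def IsLocallyPrimitive (H : Subgroup Γ.Aut) : Prop :=
  ∀ x : V, MulAction.IsPreprimitive (localAction H x) (Γ.star x)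

end SerreGraph

/-! Topological groups -/

section TopologicalGroups

variable (G : Type u) [Group G] [TopologicalSpace G]

/-- `N` is a closed cocompact normal subgroup. -/
def IsClosedNormalCocompact {G : Type u} [Group G] [TopologicalSpace G] (N : Subgroup G) : Prop :=
  N.Normal ∧ IsClosed (N : Set G) ∧ CompactSpace (G ⧸ N)

/-- The group `G^(∞)`: the intersection of all closed cocompact normal subgroups of `G`. -/
def cocompactResidual : Subgroup G := sInf {N | IsClosedNormalCocompact N}

/-- The quasi-center of `G`: the elements whose centralizer is open. -/
def quasiCenter [IsTopologicalGroup G] : Subgroup G where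
  carrier := {g | IsOpen (Subgroup.centralizer {g} : Set G)}
  one_mem' := by simp [Subgroup.centralizer_eq_top_iff_subset.2]
  mul_mem' := by
    intro a b ha hb
    refine Subgroup.isOpen_mono
      (H₁ := Subgroup.centralizer {a} ⊓ Subgroup.centralizer {b}) ?_ (IsOpen.inter ha hb)
    intro g hg
    rw [Subgroup.mem_inf, Subgroup.mem_centralizer_singleton_iff,
      Subgroup.mem_centralizer_singleton_iff] at hg
    obtain ⟨hg1, hg2⟩ := hg
    rw [Subgroup.mem_centralizer_singleton_iff]
    rw [← mul_assoc, hg1, mul_assoc, hg2, mul_assoc]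
  inv_mem' := by
    intro a ha
    refine Subgroup.isOpen_mono (H₁ := Subgroup.centralizer {a}) ?_ ha
    intro g hg
    rw [Subgroup.mem_centralizer_singleton_iff] at hg ⊢
    exact (show Commute g a from hg).inv_right

instance quasiCenter_normal [IsTopologicalGroup G] : (quasiCenter G).Normal where
  conj_mem := by
    intro a ha g
    have hc : Continuous fun k : G => g⁻¹ * k * g := by fun_prop
    have hs : (Subgroup.centralizer {g * a * g⁻¹} : Set G) =
        (fun k : G => g⁻¹ * k * g) ⁻¹' (Subgroup.centralizer {a} : Set G) := by
      ext k
      rw [Set.mem_preimage, SetLike.mem_coe, SetLike.mem_coe,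
        Subgroup.mem_centralizer_singleton_iff, Subgroup.mem_centralizer_singleton_iff]
      constructor <;> intro h
      · calc g⁻¹ * k * g * a = g⁻¹ * (k * (g * a * g⁻¹)) * g := by group
          _ = a * (g⁻¹ * k * g) := by rw [h]; group
      · calc k * (g * a * g⁻¹) = g * (g⁻¹ * k * g * a) * g⁻¹ := by group
          _ = g * a * g⁻¹ * k := by rw [h]; group
    change IsOpen (Subgroup.centralizer {g * a * g⁻¹} : Set G)
    rw [hs]
    exact IsOpen.preimage hc ha

/-- A topological group is topologically simple if it is non-trivial and its only closed normal
subgroups are the trivial one and the whole group. -/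
def IsTopologicallySimple : Prop :=
  Nontrivial G ∧ ∀ N : Subgroup G, N.Normal → IsClosed (N : Set G) → N = ⊥ ∨ N = ⊤

/-- The minimal elements, for inclusion, among the non-trivial closed normal subgroups of `G`. -/
def minimalClosedNormalSubgroups : Set (Subgroup G) :=
  {M | Minimal (fun N : Subgroup G => N ≠ ⊥ ∧ N.Normal ∧ IsClosed (N : Set G)) M}

/-- `G` is isomorphic, as a topological group, to a direct product of finitely many topologically
simple groups (realized as subgroups of `G` with the subspace topology). -/
def IsDirectProductOfTopologicallySimple : Prop :=
  ∃ (n : ℕ) (S : Fin n → Subgroup G),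
    (∀ i, IsTopologicallySimple (S i)) ∧ Nonempty (G ≃ₜ* ((i : Fin n) → S i))

/-- The subquotient `G^(∞) / QZ(G^(∞))`. -/
abbrev BMSubquotient [IsTopologicalGroup G] : Type u :=
  cocompactResidual G ⧸ quasiCenter (cocompactResidual G)

variable {G}

/-- The preimage in `G^(∞)`, regarded as a subgroup of `G`, of a subgroup of
`G^(∞) / QZ(G^(∞))`. -/
def BMSubquotient.preimage [IsTopologicalGroup G] (M : Subgroup (BMSubquotient G)) : Subgroup G :=
  (M.comap (QuotientGroup.mk' (quasiCenter (cocompactResidual G)))).map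
    (cocompactResidual G).subtype

/-- Two subgroups of `G^(∞) / QZ(G^(∞))` are `G`-conjugate if their preimages in `G^(∞)` are
conjugate by an element of `G`. -/
def BMSubquotient.AreConjugate [IsTopologicalGroup G] (M M' : Subgroup (BMSubquotient G)) : Prop :=
  ∃ g : G, MulAut.conj g • BMSubquotient.preimage M = BMSubquotient.preimage M'

end TopologicalGroups

-- Everything is read off from the action on `X = V ⊕ E`, where a subgroup is discrete exactly when
-- some finite subset of `X` has trivial pointwise fixer in it. By semiprimitivity a normal subgroup
-- is either transitive on the star at an end of some edge, and then has finitely many orbits and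
-- contains a finitely generated subgroup with finitely many orbits ("cofinite"), or semiregular on
-- all stars, and then an edge has trivial stabilizer and the subgroup is discrete.
-- `IsBurgerMozesAction` records this dichotomy, and parts (i)-(iii) use only that.
--
-- Two facts drive the abstract part. If each element of a cofinite group commutes with all
-- sufficiently small elements of `C`, then `C` is discrete
-- (`IsFinGenCofinite.hasTrivialFixer_of_commute`): a small element commutes with the finitely many
-- generators and fixes orbit representatives, hence fixes `X`. And a directed intersection of
-- closed non-discrete subgroups normalized by a cofinite group is non-discrete
-- (`not_hasTrivialFixer_iInf`), by compactness. The first shows that quasi-centers are discrete and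
-- that non-discrete normal subgroups meet non-discretely; with the second, the residual is
-- non-discrete and Zorn's lemma gives minimal closed subgroups above its quasi-center `D`. Distinct
-- minimal ones commute modulo `D`, which yields their conjugacy, finiteness and simplicity.
--
-- For (iv) it remains to see that the minimal subgroups generate the residual without taking a
-- closure. Let `P_z` be generated by the intersections of the minimal subgroups with the stabilizer
-- of the vertex `z`; it is compact, and by primitivity it is transitive or trivial on the star of
-- `z`. On a tree, suitable `P_z` glue as in an amalgam, so that the group they generate has a
-- compact stabilizer at some vertex (`IsForest.mem_of_mem_sup`). That group is therefore closed,
-- and it is normal and non-discrete, so it contains the residual (`residual_le_of_isCompact`).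

universe w

set_option linter.unusedSectionVars false

/-! ### Discreteness, cofiniteness and commutation for group actions. -/

section ProfiniteActions

/-- An action of a topological group is profinite if it is faithful, its point stabilizers are
compact and open, and the pointwise stabilizers of finite sets form a basis of neighbourhoods
of `1`. -/
structure IsProfiniteAction (A : Type u) (X : Type v) [Group A] [TopologicalSpace A]
    [MulAction A X] : Prop where
  isOpen_stabilizer : ∀ x : X, IsOpen (MulAction.stabilizer A x : Set A)
  isCompact_stabilizer : ∀ x : X, IsCompact (MulAction.stabilizer A x : Set A)
  nhds_one : ∀ U ∈ nhds (1 : A), ∃ F : Set X, F.Finite ∧ ∀ g : A, (∀ x ∈ F, g • x = x) → g ∈ U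
  faithful : ∀ g : A, (∀ x : X, g • x = x) → g = 1

/-- Some finite set is fixed pointwise by no non-trivial element of `N`. -/
def HasTrivialFixer {A : Type u} (X : Type v) [Group A] [MulAction A X] (N : Subgroup A) : Prop :=
  ∃ F : Set X, F.Finite ∧ ∀ g ∈ N, (∀ x ∈ F, g • x = x) → g = 1

/-- Some finitely generated subgroup of `N` has finitely many orbits on `X`. -/
def IsFinGenCofinite {A : Type u} (X : Type v) [Group A] [MulAction A X] (N : Subgroup A) : Prop :=
  ∃ T : Set A, T.Finite ∧ T ⊆ N ∧ ∃ F : Set X, F.Finite ∧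
    ∀ x : X, ∃ g ∈ Subgroup.closure T, ∃ f ∈ F, g • f = x

/-- Invariance of a subgroup under conjugation by the elements of `G`. -/
def IsConjInvariant {A : Type u} [Group A] (G N : Subgroup A) : Prop :=
  ∀ g ∈ G, ∀ n ∈ N, g * n * g⁻¹ ∈ N

variable {A : Type u} {X : Type v} [Group A] [MulAction A X]

theorem HasTrivialFixer.mono {M N : Subgroup A} (hN : HasTrivialFixer X N) (h : M ≤ N) :
    HasTrivialFixer X M := by
  obtain ⟨F, hF, h1⟩ := hN
  exact ⟨F, hF, fun g hg => h1 g (h hg)⟩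

theorem IsFinGenCofinite.mono {M N : Subgroup A} (hM : IsFinGenCofinite X M) (h : M ≤ N) :
    IsFinGenCofinite X N := by
  obtain ⟨T, hT, hTM, hF⟩ := hM
  exact ⟨T, hT, hTM.trans h, hF⟩

/-- A subgroup commuting with a cofinite subgroup up to a discrete subgroup is discrete. -/
theorem IsFinGenCofinite.hasTrivialFixer_of_commute
    (hfaith : ∀ g : A, (∀ x : X, g • x = x) → g = 1)
    {N C : Subgroup A} (hN : IsFinGenCofinite X N)
    (h : ∀ n ∈ N, ∃ F : Set X, F.Finite ∧ ∀ c ∈ C, (∀ x ∈ F, c • x = x) → Commute n c) :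
    HasTrivialFixer X C := by
  obtain ⟨T, hT, hTN, F, hF, hTF⟩ := hN
  choose! S hS hSc using h
  refine ⟨F ∪ ⋃ t ∈ T, S t, hF.union (hT.biUnion fun t ht => hS t (hTN ht)), fun c hc hfix => ?_⟩
  have hcomm : ∀ g ∈ Subgroup.closure T, Commute g c := by
    intro g hg
    have : Subgroup.closure T ≤ Subgroup.centralizer {c} := by
      rw [Subgroup.closure_le]
      intro t ht
      rw [SetLike.mem_coe, Subgroup.mem_centralizer_singleton_iff]
      exact hSc t (hTN ht) c hc fun x hx =>
        hfix x (Or.inr (Set.mem_biUnion ht hx))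
    exact Subgroup.mem_centralizer_singleton_iff.1 (this hg)
  refine hfaith c fun x => ?_
  obtain ⟨g, hg, f, hf, rfl⟩ := hTF x
  -- Since `c` commutes with `g` and fixes the representative `f`, it fixes `g • f`.
  rw [← mul_smul, ← (hcomm g hg).eq, mul_smul, hfix f (Or.inl hf)]

/-- If `c` fixes both `F` and `n⁻¹ F`, the commutator of `n` and `c` fixes `F`, so discreteness of
`D` kills it. This supplies the hypothesis of `IsFinGenCofinite.hasTrivialFixer_of_commute`. -/
theorem HasTrivialFixer.exists_commute {C D : Subgroup A} (hD : HasTrivialFixer X D) (n : A)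
    (h : ∀ c ∈ C, n * c * n⁻¹ * c⁻¹ ∈ D) :
    ∃ F : Set X, F.Finite ∧ ∀ c ∈ C, (∀ x ∈ F, c • x = x) → Commute n c := by
  obtain ⟨F, hF, hFD⟩ := hD
  refine ⟨F ∪ (fun x => n⁻¹ • x) '' F, hF.union (hF.image _), fun c hc hfix => ?_⟩
  have h1 := hFD _ (h c hc) fun x hx => by
    have e1 : c⁻¹ • x = x := inv_smul_eq_iff.2 (hfix x (Or.inl hx)).symm
    rw [mul_smul, e1, mul_smul, mul_smul, hfix _ (Or.inr ⟨x, hx, rfl⟩), smul_inv_smul]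
  rwa [← commutatorElement_def, commutatorElement_eq_one_iff_commute] at h1

end ProfiniteActions

/-! ### Topological consequences of a profinite action. -/

section ProfiniteActions

variable {A : Type u} {X : Type v} [Group A] [TopologicalSpace A] [IsTopologicalGroup A]
  [MulAction A X]

namespace IsProfiniteAction

theorem isOpen_fixer (hA : IsProfiniteAction A X) {F : Set X} (hF : F.Finite) :
    IsOpen {g : A | ∀ x ∈ F, g • x = x} := by
  have : {g : A | ∀ x ∈ F, g • x = x} = ⋂ x ∈ F, (MulAction.stabilizer A x : Set A) := by
    ext g; simp
  rw [this]
  exact hF.isOpen_biInter fun x _ => hA.isOpen_stabilizer x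

theorem isClosed_stabilizer (hA : IsProfiniteAction A X) (x : X) :
    IsClosed (MulAction.stabilizer A x : Set A) :=
  Subgroup.isClosed_of_isOpen _ (hA.isOpen_stabilizer x)

theorem isClosed_fixer (hA : IsProfiniteAction A X) (F : Set X) :
    IsClosed {g : A | ∀ x ∈ F, g • x = x} := by
  have : {g : A | ∀ x ∈ F, g • x = x} = ⋂ x ∈ F, (MulAction.stabilizer A x : Set A) := by
    ext g; simp
  rw [this]
  exact isClosed_biInter fun x _ => hA.isClosed_stabilizer x

theorem t2Space (hA : IsProfiniteAction A X) : T2Space A := by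
  have h1 : IsClosed ({1} : Set A) := by
    have : ({1} : Set A) = {g : A | ∀ x ∈ (Set.univ : Set X), g • x = x} := by
      ext g
      simp only [Set.mem_singleton_iff, Set.mem_ofPred_eq, Set.mem_univ, true_implies]
      exact ⟨fun h => by simp [h], hA.faithful g⟩
    rw [this]
    exact hA.isClosed_fixer _
  have := IsTopologicalGroup.t1Space A h1
  infer_instance

theorem hasTrivialFixer_iff (hA : IsProfiniteAction A X) (N : Subgroup A) :
    HasTrivialFixer X N ↔ DiscreteTopology N := by
  rw [discreteTopology_iff_isOpen_singleton_one, isOpen_induced_iff]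
  constructor
  · rintro ⟨F, hF, h⟩
    refine ⟨_, hA.isOpen_fixer hF, ?_⟩
    ext g
    simp only [Set.mem_preimage, Set.mem_ofPred_eq, Set.mem_singleton_iff]
    refine ⟨fun hg => Subtype.ext (h g g.2 hg), ?_⟩
    rintro rfl x _
    exact one_smul A x
  · rintro ⟨U, hU, h⟩
    have h1 : (1 : A) ∈ U := by
      have : (1 : N) ∈ Subtype.val ⁻¹' U := by rw [h]; rfl
      exact this
    obtain ⟨F, hF, hFU⟩ := hA.nhds_one U (hU.mem_nhds h1)
    refine ⟨F, hF, fun g hg hfix => ?_⟩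
    have : (⟨g, hg⟩ : N) ∈ Subtype.val ⁻¹' U := hFU g hfix
    rw [h] at this
    exact congrArg Subtype.val this

theorem isOpen_subgroup_iff (hA : IsProfiniteAction A X) (G : Subgroup A) (K : Subgroup G) :
    IsOpen (K : Set G) ↔
      ∃ F : Set X, F.Finite ∧ ∀ g : G, (∀ x ∈ F, (g : A) • x = x) → g ∈ K := by
  constructor
  · intro hK
    obtain ⟨U, hU, hUK⟩ := isOpen_induced_iff.1 hK
    have h1 : (1 : A) ∈ U := by
      have : (1 : G) ∈ Subtype.val ⁻¹' U := by rw [hUK]; exact K.one_mem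
      exact this
    obtain ⟨F, hF, hFU⟩ := hA.nhds_one U (hU.mem_nhds h1)
    refine ⟨F, hF, fun g hg => ?_⟩
    have : g ∈ Subtype.val ⁻¹' U := hFU g hg
    rwa [hUK] at this
  · rintro ⟨F, hF, h⟩
    refine Subgroup.isOpen_of_mem_nhds (g := 1) K (Filter.mem_of_superset
      (((hA.isOpen_fixer hF).preimage continuous_subtype_val).mem_nhds ?_) h)
    intro x _
    exact one_smul A x

theorem mem_quasiCenter_subgroup (hA : IsProfiniteAction A X) (G : Subgroup A) (c : G) :
    c ∈ quasiCenter G ↔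
      ∃ F : Set X, F.Finite ∧ ∀ g ∈ G, (∀ x ∈ F, g • x = x) → Commute (c : A) g := by
  refine (hA.isOpen_subgroup_iff G (Subgroup.centralizer {c})).trans ?_
  refine exists_congr fun F => and_congr_right fun _ => ?_
  simp only [Subgroup.mem_centralizer_singleton_iff, Subtype.forall]
  refine forall₂_congr fun g hg => imp_congr_right fun _ => ?_
  exact ⟨fun h => (congrArg Subtype.val h).symm, fun h => Subtype.ext h.symm⟩

theorem mem_quasiCenter (hA : IsProfiniteAction A X) (c : A) :
    c ∈ quasiCenter A ↔
      ∃ F : Set X, F.Finite ∧ ∀ g : A, (∀ x ∈ F, g • x = x) → Commute c g := by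
  constructor
  · intro hc
    obtain ⟨F, hF, h⟩ := hA.nhds_one _
      (IsOpen.mem_nhds (show IsOpen (Subgroup.centralizer {c} : Set A) from hc)
        (Subgroup.one_mem _))
    exact ⟨F, hF, fun g hg => (Subgroup.mem_centralizer_singleton_iff.1 (h g hg)).symm⟩
  · rintro ⟨F, hF, h⟩
    refine Subgroup.isOpen_of_mem_nhds (g := 1) (Subgroup.centralizer {c})
      (Filter.mem_of_superset ((hA.isOpen_fixer hF).mem_nhds ?_) fun g hg =>
        Subgroup.mem_centralizer_singleton_iff.2 (h g hg).symm)
    intro x _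
    exact one_smul A x

/-- Modulo `N`, any `g` can be changed so that `g • x₀` lies in the finite set `F`. The quotient is
thus the image of finitely many cosets of the compact stabilizer of `x₀`. -/
theorem compactSpace_quotient (hA : IsProfiniteAction A X) [Nonempty X] {N : Subgroup A}
    (hNn : N.Normal) (hN : IsFinGenCofinite X N) : CompactSpace (A ⧸ N) := by
  obtain ⟨T, hT, hTN, F, hF, hTF⟩ := hN
  obtain ⟨x₀⟩ := ‹Nonempty X›
  have hcl : Subgroup.closure T ≤ N := (Subgroup.closure_le _).2 hTN
  classical
  -- The value `1` is a dummy for points outside the orbit of `x₀`.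
  have hex : ∀ f : X, ∃ a : A, (∃ b : A, b • x₀ = f) → a • x₀ = f := fun f => by
    by_cases h : ∃ b : A, b • x₀ = f
    · exact ⟨h.choose, fun _ => h.choose_spec⟩
    · exact ⟨1, fun h' => absurd h' h⟩
  choose a ha using hex
  have hcpt : IsCompact (⋃ f ∈ F, (fun s : A => (a f * s : A)) ''
      (MulAction.stabilizer A x₀ : Set A)) :=
    hF.isCompact_biUnion fun f _ => (hA.isCompact_stabilizer x₀).image (by fun_prop)
  have hcpt2 := hcpt.image (f := (QuotientGroup.mk : A → A ⧸ N)) continuous_quot_mk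
  refine ⟨?_⟩
  convert hcpt2
  symm
  rw [Set.eq_univ_iff_forall]
  intro q
  obtain ⟨g, rfl⟩ := QuotientGroup.mk_surjective q
  obtain ⟨n, hn, f, hf, hfx⟩ := hTF (g • x₀)
  have hb : (n⁻¹ * g) • x₀ = f := by rw [mul_smul, ← hfx, inv_smul_smul]
  have haf := ha f ⟨_, hb⟩
  refine ⟨n⁻¹ * g, Set.mem_biUnion hf ⟨(a f)⁻¹ * (n⁻¹ * g), ?_, by group⟩, ?_⟩
  · rw [SetLike.mem_coe, MulAction.mem_stabilizer_iff, mul_smul, hb, inv_smul_eq_iff, haf]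
  · rw [QuotientGroup.eq]
    have := hNn.conj_mem n (hcl hn) g⁻¹
    simpa [mul_assoc] using this

/-- The intersection of a directed family of non-discrete closed subgroups invariant under a
cofinite group is non-discrete. -/
theorem not_hasTrivialFixer_iInf (hA : IsProfiniteAction A X) [Nonempty X] {G : Subgroup A}
    (hG : IsFinGenCofinite X G) {ι : Type*} [Nonempty ι] (N : ι → Subgroup A)
    (hdir : Directed (· ≥ ·) N) (hcl : ∀ i, IsClosed (N i : Set A))
    (hinv : ∀ i, IsConjInvariant G (N i)) (hnd : ∀ i, ¬ HasTrivialFixer X (N i)) :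
    ¬ HasTrivialFixer X (⨅ i, N i) := by
  rintro ⟨F₀, hF₀, hF₀1⟩
  obtain ⟨T, hT, hTG, F, hF, hTF⟩ := hG
  obtain ⟨x₀⟩ := ‹Nonempty X›
  set F₁ : Set X := insert x₀ (F₀ ∪ F) with hF₁
  have hF₁f : F₁.Finite := (hF₀.union hF).insert x₀
  set F₂ : Set X := ⋃ t ∈ T, ((fun x => t • x) '' F₁ ∪ (fun x => t⁻¹ • x) '' F₁) with hF₂
  have hF₂f : F₂.Finite := hT.biUnion fun t _ => (hF₁f.image _).union (hF₁f.image _)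
  set U₁ : Set A := {g : A | ∀ x ∈ F₁, g • x = x} with hU₁
  set U₂ : Set A := {g : A | ∀ x ∈ F₂, g • x = x} with hU₂
  have hU₁c : IsCompact U₁ := (hA.isCompact_stabilizer x₀).of_isClosed_subset
    (hA.isClosed_fixer F₁) fun g hg => hg x₀ (Set.mem_insert _ _)
  have hKc : IsCompact (U₁ \ U₂) := hU₁c.diff (hA.isOpen_fixer hF₂f)
  have hempty : (U₁ \ U₂) ∩ ⋂ i, (N i : Set A) = ∅ := by
    rw [Set.eq_empty_iff_forall_notMem]
    rintro g ⟨⟨hg1, hg2⟩, hg⟩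
    have : g = 1 := hF₀1 g (by simpa [Subgroup.mem_iInf] using hg) fun x hx =>
      hg1 x (Or.inr (Or.inl hx))
    exact hg2 (by rw [this]; intro x _; exact one_smul A x)
  -- The compact set `U₁ \ U₂` misses the intersection, hence misses a single `N i`: there, fixing
  -- `F₁` already forces fixing all `t • F₁` and `t⁻¹ • F₁`.
  obtain ⟨i, hi⟩ := hKc.elim_directed_family_closed (fun i => (N i : Set A)) hcl hempty
    (fun i j => by
      obtain ⟨k, hk1, hk2⟩ := hdir i j
      exact ⟨k, hk1, hk2⟩)
  have hstep : ∀ k ∈ N i, k ∈ U₁ → k ∈ U₂ := by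
    intro k hk hk1
    by_contra hk2
    have : k ∈ (U₁ \ U₂) ∩ (N i : Set A) := ⟨⟨hk1, hk2⟩, hk⟩
    rw [hi] at this
    exact this
  refine hnd i ⟨F₁, hF₁f, fun k hk hk1 => hA.faithful k fun x => ?_⟩
  -- So `N i ∩ U₁` is normalized by the generators, and therefore by the group they generate. Fixing
  -- representatives of its orbits, it fixes all of `X`.
  have hconj : ∀ g ∈ Subgroup.closure T,
      (∀ k ∈ N i, k ∈ U₁ → g * k * g⁻¹ ∈ N i ∧ g * k * g⁻¹ ∈ U₁) ∧
      (∀ k ∈ N i, k ∈ U₁ → g⁻¹ * k * g ∈ N i ∧ g⁻¹ * k * g ∈ U₁) := by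
    intro g hg
    induction hg using Subgroup.closure_induction with
    | mem t ht =>
      refine ⟨fun k hk hk1 => ⟨hinv i t (hTG ht) k hk, fun y hy => ?_⟩, fun k hk hk1 => ⟨?_, fun y hy => ?_⟩⟩
      · rw [mul_smul, mul_smul, hstep k hk hk1 (t⁻¹ • y)
          (Set.mem_biUnion ht (Or.inr ⟨y, hy, rfl⟩)), smul_inv_smul]
      · simpa using hinv i t⁻¹ (G.inv_mem (hTG ht)) k hk
      · rw [mul_smul, mul_smul, hstep k hk hk1 (t • y)
          (Set.mem_biUnion ht (Or.inl ⟨y, hy, rfl⟩)), inv_smul_smul]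
    | one => simpa using fun k hk hk1 => ⟨hk, hk1⟩
    | mul a b _ _ iha ihb =>
      refine ⟨fun k hk hk1 => ?_, fun k hk hk1 => ?_⟩
      · have h1 := ihb.1 k hk hk1
        have h2 := iha.1 _ h1.1 h1.2
        simpa [mul_assoc] using h2
      · have h1 := iha.2 k hk hk1
        have h2 := ihb.2 _ h1.1 h1.2
        simpa [mul_assoc] using h2
    | inv a _ ih => exact ⟨by simpa using ih.2, by simpa using ih.1⟩
  obtain ⟨g, hg, f, hf, rfl⟩ := hTF x
  have h := ((hconj g hg).2 k hk hk1).2 f (Or.inr (Or.inr hf))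
  rwa [mul_smul, mul_smul, inv_smul_eq_iff] at h

end IsProfiniteAction

end ProfiniteActions

/-! ### Burger–Mozes actions: quasi-center and cocompact residual. -/

section ProfiniteActions

variable {A : Type u} {X : Type v} [Group A] [TopologicalSpace A] [IsTopologicalGroup A]
  [MulAction A X]

/-- A non-discrete profinite action for which a normal subgroup is discrete or cofinite. -/
structure IsBurgerMozesAction (A : Type u) (X : Type v) [Group A] [TopologicalSpace A]
    [MulAction A X] : Prop extends IsProfiniteAction A X where
  not_discrete : ¬ HasTrivialFixer X (⊤ : Subgroup A)
  isFinGenCofinite : ∀ N : Subgroup A, N.Normal → ¬ HasTrivialFixer X N → IsFinGenCofinite X N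
  isFinGenCofinite_of_compactSpace :
    ∀ N : Subgroup A, N.Normal → CompactSpace (A ⧸ N) → IsFinGenCofinite X N

namespace IsBurgerMozesAction

theorem nonempty (hA : IsBurgerMozesAction A X) : Nonempty X := by
  by_contra h
  rw [not_nonempty_iff] at h
  exact hA.not_discrete ⟨∅, Set.finite_empty, fun g _ _ => hA.faithful g fun x => h.elim x⟩

/-- Quasi-central elements commute with all small elements of `A`, so a cofinite quasi-center would
make `A` itself discrete. -/
theorem not_isFinGenCofinite_quasiCenter (hA : IsBurgerMozesAction A X) :
    ¬ IsFinGenCofinite X (quasiCenter A) := fun h =>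
  hA.not_discrete (h.hasTrivialFixer_of_commute hA.faithful fun n hn => by
    obtain ⟨F, hF, hc⟩ := (hA.mem_quasiCenter n).1 hn
    exact ⟨F, hF, fun c _ => hc c⟩)

theorem hasTrivialFixer_quasiCenter (hA : IsBurgerMozesAction A X) :
    HasTrivialFixer X (quasiCenter A) := by
  by_contra h
  exact hA.not_isFinGenCofinite_quasiCenter (hA.isFinGenCofinite _ inferInstance h)

/-- Commutators of `n ∈ N` with elements of `A` stay in the discrete group `N`, hence vanish near
`1`. -/
theorem le_quasiCenter (hA : IsBurgerMozesAction A X) {N : Subgroup A} (hN : N.Normal)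
    (hd : HasTrivialFixer X N) : N ≤ quasiCenter A := by
  intro n hn
  rw [hA.mem_quasiCenter]
  obtain ⟨F, hF, h⟩ := hd.exists_commute (C := ⊤) n fun c _ => by
    have := N.mul_mem hn (hN.conj_mem _ (N.inv_mem hn) c)
    simpa [mul_assoc] using this
  exact ⟨F, hF, fun c => h c trivial⟩

theorem maximal_quasiCenter (hA : IsBurgerMozesAction A X) :
    Maximal (fun N : Subgroup A => N.Normal ∧ DiscreteTopology N) (quasiCenter A) :=
  ⟨⟨inferInstance, (hA.hasTrivialFixer_iff _).1 hA.hasTrivialFixer_quasiCenter⟩,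
    fun _ hN _ => hA.le_quasiCenter hN.1 ((hA.hasTrivialFixer_iff _).2 hN.2)⟩

theorem not_compactSpace_quasiCenter (hA : IsBurgerMozesAction A X) :
    ¬ CompactSpace (A ⧸ quasiCenter A) := fun h =>
  hA.not_isFinGenCofinite_quasiCenter (hA.isFinGenCofinite_of_compactSpace _ inferInstance h)

theorem not_hasTrivialFixer_of_isFinGenCofinite (hA : IsBurgerMozesAction A X) {N : Subgroup A}
    (hN : N.Normal) (h : IsFinGenCofinite X N) : ¬ HasTrivialFixer X N := fun hd =>
  hA.not_isFinGenCofinite_quasiCenter (h.mono (hA.le_quasiCenter hN hd))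

/-- For normal subgroups, cocompact, cofinite and non-discrete are the same; non-discreteness is the
form that behaves well under intersections. -/
theorem isClosedNormalCocompact_iff (hA : IsBurgerMozesAction A X) (N : Subgroup A) :
    IsClosedNormalCocompact N ↔ N.Normal ∧ IsClosed (N : Set A) ∧ ¬ HasTrivialFixer X N := by
  have := hA.nonempty
  refine and_congr_right fun hN => and_congr_right fun _ => ⟨fun h => ?_, fun h => ?_⟩
  · exact hA.not_hasTrivialFixer_of_isFinGenCofinite hN
      (hA.isFinGenCofinite_of_compactSpace N hN h)
  · exact hA.compactSpace_quotient hN (hA.isFinGenCofinite N hN h)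

/-- Commutators of `M` and `N` lie in `M ⊓ N`. Were it discrete, elements of the cofinite group `M`
would commute with small elements of `N`, making `N` discrete. -/
theorem not_hasTrivialFixer_inf (hA : IsBurgerMozesAction A X) {M N : Subgroup A} (hM : M.Normal)
    (hN : N.Normal) (hMd : ¬ HasTrivialFixer X M) (hNd : ¬ HasTrivialFixer X N) :
    ¬ HasTrivialFixer X (M ⊓ N) := fun hd =>
  hNd ((hA.isFinGenCofinite M hM hMd).hasTrivialFixer_of_commute hA.faithful fun n hn =>
    hd.exists_commute n fun c hc => ⟨by
      have := M.mul_mem hn (hM.conj_mem _ (M.inv_mem hn) c)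
      simpa [mul_assoc] using this, N.mul_mem (hN.conj_mem _ hc n) (N.inv_mem hc)⟩)

instance normal_cocompactResidual {G : Type*} [Group G] [TopologicalSpace G] :
    (cocompactResidual G).Normal where
  conj_mem n hn g := by
    rw [cocompactResidual, Subgroup.mem_sInf] at hn ⊢
    exact fun N hN => hN.1.conj_mem n (hn N hN) g

theorem isClosed_cocompactResidual {G : Type*} [Group G] [TopologicalSpace G] :
    IsClosed (cocompactResidual G : Set G) := by
  rw [cocompactResidual, Subgroup.coe_sInf]
  exact isClosed_biInter fun N hN => hN.2.1

/-- By `not_hasTrivialFixer_inf` the closed normal cocompact subgroups form a directed family, so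
compactness applies to their intersection. -/
theorem not_hasTrivialFixer_cocompactResidual (hA : IsBurgerMozesAction A X) :
    ¬ HasTrivialFixer X (cocompactResidual A) := by
  have := hA.nonempty
  have htop : IsClosedNormalCocompact (⊤ : Subgroup A) :=
    (hA.isClosedNormalCocompact_iff _).2 ⟨inferInstance, isClosed_univ, hA.not_discrete⟩
  have : Nonempty {N : Subgroup A | IsClosedNormalCocompact N} := ⟨⟨⊤, htop⟩⟩
  have h := hA.not_hasTrivialFixer_iInf (G := ⊤)
    (hA.isFinGenCofinite ⊤ inferInstance hA.not_discrete)
    (fun N : {N : Subgroup A | IsClosedNormalCocompact N} => (N : Subgroup A))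
    (fun M N => by
      obtain ⟨hM1, hM2, hM3⟩ := (hA.isClosedNormalCocompact_iff _).1 M.2
      obtain ⟨hN1, hN2, hN3⟩ := (hA.isClosedNormalCocompact_iff _).1 N.2
      exact ⟨⟨M ⊓ N, (hA.isClosedNormalCocompact_iff _).2
        ⟨inferInstance, hM2.inter hN2, hA.not_hasTrivialFixer_inf hM1 hN1 hM3 hN3⟩⟩,
        inf_le_left, inf_le_right⟩)
    (fun N => N.2.2.1) (fun N g _ n hn => N.2.1.conj_mem n hn g)
    (fun N => ((hA.isClosedNormalCocompact_iff _).1 N.2).2.2)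
  rwa [← sInf_eq_iInf'] at h

theorem minimal_cocompactResidual (hA : IsBurgerMozesAction A X) :
    Minimal IsClosedNormalCocompact (cocompactResidual A) :=
  ⟨(hA.isClosedNormalCocompact_iff _).2 ⟨inferInstance, isClosed_cocompactResidual,
    hA.not_hasTrivialFixer_cocompactResidual⟩, fun _ hN _ => sInf_le hN⟩

theorem cocompactResidual_le (hA : IsBurgerMozesAction A X) {N : Subgroup A} (hN : N.Normal)
    (hcl : IsClosed (N : Set A)) (hd : ¬ HasTrivialFixer X N) : cocompactResidual A ≤ N :=
  sInf_le ((hA.isClosedNormalCocompact_iff _).2 ⟨hN, hcl, hd⟩)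

end IsBurgerMozesAction

/-! ### The quasi-center of the residual, viewed inside `A`. -/

variable (A) in
/-- The quasi-center of `A^(∞)`, as a subgroup of `A`. -/
def residualQuasiCenter : Subgroup A :=
  (quasiCenter (cocompactResidual A)).map (cocompactResidual A).subtype

namespace IsBurgerMozesAction

theorem mem_residualQuasiCenter (hA : IsBurgerMozesAction A X) (a : A) :
    a ∈ residualQuasiCenter A ↔ a ∈ cocompactResidual A ∧
      ∃ F : Set X, F.Finite ∧ ∀ g ∈ cocompactResidual A, (∀ x ∈ F, g • x = x) → Commute a g := by
  rw [residualQuasiCenter, Subgroup.mem_map]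
  constructor
  · rintro ⟨c, hc, rfl⟩
    exact ⟨c.2, (hA.mem_quasiCenter_subgroup _ c).1 hc⟩
  · rintro ⟨ha, h⟩
    exact ⟨⟨a, ha⟩, (hA.mem_quasiCenter_subgroup _ ⟨a, ha⟩).2 h, rfl⟩

theorem residualQuasiCenter_le : residualQuasiCenter A ≤ cocompactResidual A :=
  Subgroup.map_subtype_le _

theorem normal_residualQuasiCenter (hA : IsBurgerMozesAction A X) :
    (residualQuasiCenter A).Normal where
  conj_mem n hn a := by
    rw [hA.mem_residualQuasiCenter] at hn ⊢
    obtain ⟨hn, F, hF, h⟩ := hn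
    refine ⟨IsBurgerMozesAction.normal_cocompactResidual.conj_mem n hn a,
      (fun x => a • x) '' F, hF.image _, fun g hg hfix => ?_⟩
    have := h (a⁻¹ * g * a)
      (by simpa using IsBurgerMozesAction.normal_cocompactResidual.conj_mem g hg a⁻¹)
      fun x hx => by rw [mul_smul, mul_smul, hfix _ ⟨x, hx, rfl⟩, inv_smul_smul]
    calc a * n * a⁻¹ * g = a * (n * (a⁻¹ * g * a)) * a⁻¹ := by group
      _ = g * (a * n * a⁻¹) := by rw [this.eq]; group

/-- It is normal in all of `A`, so if non-discrete it would be cofinite; its elements commute with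
small elements of the residual, which would then be discrete. -/
theorem hasTrivialFixer_residualQuasiCenter (hA : IsBurgerMozesAction A X) :
    HasTrivialFixer X (residualQuasiCenter A) := by
  by_contra h
  refine hA.not_hasTrivialFixer_cocompactResidual
    ((hA.isFinGenCofinite _ hA.normal_residualQuasiCenter h).hasTrivialFixer_of_commute
      hA.faithful fun n hn => ?_)
  exact ((hA.mem_residualQuasiCenter n).1 hn).2

theorem isClosed_residualQuasiCenter (hA : IsBurgerMozesAction A X) :
    IsClosed (residualQuasiCenter A : Set A) := by
  have := hA.t2Space
  have := (hA.hasTrivialFixer_iff _).1 hA.hasTrivialFixer_residualQuasiCenter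
  exact Subgroup.isClosed_of_discrete

/-- The non-formal inclusion holds because the left side is a discrete normal subgroup of `A`, not
merely of the residual. -/
theorem quasiCenter_cocompactResidual (hA : IsBurgerMozesAction A X) :
    quasiCenter (cocompactResidual A) =
      (quasiCenter A).subgroupOf (cocompactResidual A) := by
  ext c
  rw [Subgroup.mem_subgroupOf]
  constructor
  · intro hc
    exact hA.le_quasiCenter hA.normal_residualQuasiCenter hA.hasTrivialFixer_residualQuasiCenter
      ⟨c, hc, rfl⟩
  · intro hc
    rw [hA.mem_quasiCenter_subgroup]
    obtain ⟨F, hF, h⟩ := (hA.mem_quasiCenter _).1 hc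
    exact ⟨F, hF, fun g _ => h g⟩

theorem mem_residualQuasiCenter_of_commutator (hA : IsBurgerMozesAction A X) {D : Subgroup A}
    (hD : HasTrivialFixer X D) {m : A} (hm : m ∈ cocompactResidual A)
    (h : ∀ g ∈ cocompactResidual A, m * g * m⁻¹ * g⁻¹ ∈ D) : m ∈ residualQuasiCenter A :=
  (hA.mem_residualQuasiCenter m).2 ⟨hm, hD.exists_commute m h⟩

theorem le_residualQuasiCenter (hA : IsBurgerMozesAction A X) {N : Subgroup A}
    (hd : HasTrivialFixer X N) (hle : N ≤ cocompactResidual A)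
    (hN : IsConjInvariant (cocompactResidual A) N) : N ≤ residualQuasiCenter A := fun n hn =>
  hA.mem_residualQuasiCenter_of_commutator hd (hle hn) fun g hg => by
    have := N.mul_mem hn (hN g hg _ (N.inv_mem hn))
    simpa [mul_assoc] using this

end IsBurgerMozesAction

/-! ### Minimal admissible subgroups: existence, conjugacy, finiteness, simplicity. -/

variable (A) in
/-- The closed subgroups of `A^(∞)`, normal in `A^(∞)`, that properly contain its quasi-center. -/
structure IsAdmissible (N : Subgroup A) : Prop where
  le : residualQuasiCenter A ≤ N
  ne : N ≠ residualQuasiCenter A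
  le_residual : N ≤ cocompactResidual A
  conj : IsConjInvariant (cocompactResidual A) N
  isClosed : IsClosed (N : Set A)

namespace IsBurgerMozesAction

theorem _root_.IsAdmissible.not_hasTrivialFixer (hA : IsBurgerMozesAction A X) {N : Subgroup A}
    (hN : IsAdmissible A N) : ¬ HasTrivialFixer X N := fun hd =>
  hN.ne (le_antisymm (hA.le_residualQuasiCenter hd hN.le_residual hN.conj) hN.le)

theorem isFinGenCofinite_cocompactResidual (hA : IsBurgerMozesAction A X) :
    IsFinGenCofinite X (cocompactResidual A) :=
  hA.isFinGenCofinite _ inferInstance hA.not_hasTrivialFixer_cocompactResidual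

theorem isAdmissible_cocompactResidual (hA : IsBurgerMozesAction A X) :
    IsAdmissible A (cocompactResidual A) where
  le := residualQuasiCenter_le
  ne h := hA.not_hasTrivialFixer_cocompactResidual (by
    rw [h]; exact hA.hasTrivialFixer_residualQuasiCenter)
  le_residual := le_rfl
  conj g hg n hn := mul_mem (mul_mem hg hn) (inv_mem hg)
  isClosed := isClosed_cocompactResidual

/-- Zorn's lemma for reverse inclusion. The intersection of a chain stays non-discrete by
`not_hasTrivialFixer_iInf`, and so cannot drop to the discrete quasi-center. -/
theorem exists_minimal_le (hA : IsBurgerMozesAction A X) {N : Subgroup A}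
    (hN : IsAdmissible A N) : ∃ M ≤ N, Minimal (IsAdmissible A) M := by
  have := hA.nonempty
  suffices h : ∃ M, OrderDual.toDual N ≤ M ∧
      Maximal (· ∈ {M : (Subgroup A)ᵒᵈ | IsAdmissible A (OrderDual.ofDual M)}) M by
    obtain ⟨M, hle, hM⟩ := h
    exact ⟨OrderDual.ofDual M, hle, hM.1, fun K hK h => hM.2 (y := OrderDual.toDual K) hK h⟩
  refine zorn_le_nonempty₀ _ (fun c hc hchain y hy => ?_) (OrderDual.toDual N) hN
  have : Nonempty c := ⟨⟨y, hy⟩⟩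
  have hinf : ¬ HasTrivialFixer X (⨅ M : c, OrderDual.ofDual (M : (Subgroup A)ᵒᵈ)) :=
    hA.not_hasTrivialFixer_iInf hA.isFinGenCofinite_cocompactResidual _
      (fun M M' => by
        rcases hchain.total M.2 M'.2 with h | h
        · exact ⟨M', h, le_rfl⟩
        · exact ⟨M, le_rfl, h⟩)
      (fun M => (hc M.2).isClosed) (fun M => (hc M.2).conj)
      (fun M => (hc M.2).not_hasTrivialFixer hA)
  refine ⟨OrderDual.toDual (⨅ M : c, OrderDual.ofDual (M : (Subgroup A)ᵒᵈ)), ?_, fun M hM =>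
    iInf_le (fun M : c => OrderDual.ofDual (M : (Subgroup A)ᵒᵈ)) ⟨M, hM⟩⟩
  refine ⟨le_iInf fun M => (hc M.2).le, fun h => hinf ?_,
    (iInf_le (fun M : c => OrderDual.ofDual (M : (Subgroup A)ᵒᵈ)) ⟨y, hy⟩).trans
      (hc hy).le_residual, ?_, ?_⟩
  · have h' : (⨅ M : c, OrderDual.ofDual (M : (Subgroup A)ᵒᵈ)) = residualQuasiCenter A := h
    rw [h']
    exact hA.hasTrivialFixer_residualQuasiCenter
  · intro g hg n hn
    have hn' := Subgroup.mem_iInf.1 hn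
    exact Subgroup.mem_iInf.2 fun M => (hc M.2).conj g hg n (hn' M)
  · change IsClosed ((⨅ M : c, OrderDual.ofDual (M : (Subgroup A)ᵒᵈ) : Subgroup A) : Set A)
    rw [Subgroup.coe_iInf]
    exact isClosed_iInter fun M => (hc M.2).isClosed

theorem inf_eq_of_minimal {M M' : Subgroup A} (hM : Minimal (IsAdmissible A) M)
    (hM' : Minimal (IsAdmissible A) M') (hne : M ≠ M') : M ⊓ M' = residualQuasiCenter A := by
  by_contra h
  have hadm : IsAdmissible A (M ⊓ M') := ⟨le_inf hM.1.le hM'.1.le, h,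
    inf_le_left.trans hM.1.le_residual,
    fun g hg n hn => ⟨hM.1.conj g hg n hn.1, hM'.1.conj g hg n hn.2⟩,
    hM.1.isClosed.inter hM'.1.isClosed⟩
  exact hne ((le_antisymm (hM.2 hadm inf_le_left |>.trans inf_le_right)
    (hM'.2 hadm inf_le_right |>.trans inf_le_left)))

/-- Both subgroups are normal in the residual, so commutators lie in their intersection, which by
minimality is only the quasi-center. -/
theorem commutator_mem_of_minimal {M M' : Subgroup A} (hM : Minimal (IsAdmissible A) M)
    (hM' : Minimal (IsAdmissible A) M') (hne : M ≠ M') {m m' : A} (hm : m ∈ M) (hm' : m' ∈ M') :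
    m * m' * m⁻¹ * m'⁻¹ ∈ residualQuasiCenter A := by
  rw [← inf_eq_of_minimal hM hM' hne]
  refine ⟨?_, mul_mem (hM'.1.conj m (hM.1.le_residual hm) m' hm') (M'.inv_mem hm')⟩
  have := mul_mem hm (hM.1.conj m' (hM'.1.le_residual hm') m⁻¹ (inv_mem hm))
  simpa [mul_assoc] using this

theorem mem_conj_iff {M : Subgroup A} {a n : A} :
    n ∈ MulAut.conj a • M ↔ a⁻¹ * n * a ∈ M := by
  rw [Subgroup.mem_pointwise_smul_iff_inv_smul_mem, ← map_inv, MulAut.smul_def,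
    MulAut.conj_apply, inv_inv]

theorem _root_.IsAdmissible.conj_smul (hA : IsBurgerMozesAction A X) {M : Subgroup A}
    (hM : IsAdmissible A M) (a : A) : IsAdmissible A (MulAut.conj a • M) := by
  have hD := hA.normal_residualQuasiCenter
  have hG : (cocompactResidual A).Normal := inferInstance
  have key : ∀ {n : A} {N : Subgroup A} (_ : N.Normal), a⁻¹ * n * a ∈ N ↔ n ∈ N := by
    intro n N hN
    have := hN.mem_comm_iff (a := a⁻¹ * n) (b := a)
    simpa using this
  refine ⟨fun n hn => mem_conj_iff.2 (hM.le ((key hD).2 hn)), fun h => hM.ne ?_,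
    fun n hn => (key hG).1 (hM.le_residual (mem_conj_iff.1 hn)), fun g hg n hn => ?_, ?_⟩
  · refine le_antisymm (fun n hn => ?_) hM.le
    have : a * n * a⁻¹ ∈ MulAut.conj a • M := mem_conj_iff.2 (by simpa [mul_assoc] using hn)
    rw [h, ← key hD] at this
    simpa [mul_assoc] using this
  · rw [mem_conj_iff] at hn ⊢
    have := hM.conj (a⁻¹ * g * a) ((key hG).2 hg) _ hn
    simpa [mul_assoc] using this
  · have : ((MulAut.conj a • M : Subgroup A) : Set A) = (fun n => a⁻¹ * n * a) ⁻¹' (M : Set A) := by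
      ext n
      exact mem_conj_iff
    rw [this]
    exact hM.isClosed.preimage (by fun_prop)

theorem minimal_conj_smul (hA : IsBurgerMozesAction A X) {M : Subgroup A}
    (hM : Minimal (IsAdmissible A) M) (a : A) :
    Minimal (IsAdmissible A) (MulAut.conj a • M) := by
  refine ⟨hM.1.conj_smul hA a, fun N hN hle => ?_⟩
  have h1 := hM.2 (hN.conj_smul hA a⁻¹) (by
    rw [map_inv, ← Subgroup.subset_pointwise_smul_iff]
    exact hle)
  rwa [map_inv, ← Subgroup.pointwise_smul_subset_iff] at h1

/-- The conjugates of `M` generate a normal subgroup of `A` whose closure is non-discrete and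
therefore contains the residual. Closed conditions can thus be checked on conjugates of `M` alone.
-/
theorem le_of_forall_conj_le (hA : IsBurgerMozesAction A X) {M : Subgroup A}
    (hM : IsAdmissible A M) {Z : Subgroup A} (hZ : IsClosed (Z : Set A))
    (h : ∀ a : A, MulAut.conj a • M ≤ Z) : cocompactResidual A ≤ Z := by
  have hnorm : (⨆ a : A, MulAut.conj a • M).Normal := by
    refine ⟨fun n hn g => ?_⟩
    induction hn using Subgroup.iSup_induction' with
    | hp a n hn =>
      refine Subgroup.mem_iSup_of_mem (g * a) (mem_conj_iff.2 ?_)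
      have := mem_conj_iff.1 hn
      simpa [mul_assoc] using this
    | h1 => simp
    | hmul x y _ _ hx hy => simpa [mul_assoc] using mul_mem hx hy
  have hle : M ≤ ⨆ a : A, MulAut.conj a • M := by
    refine le_trans (le_of_eq ?_) (le_iSup _ 1)
    simp
  have := hA.cocompactResidual_le (Subgroup.is_normal_topologicalClosure _)
    (Subgroup.isClosed_topologicalClosure _) fun hd => hM.not_hasTrivialFixer hA
      (hd.mono (hle.trans (Subgroup.le_topologicalClosure _)))
  exact this.trans (Subgroup.topologicalClosure_minimal _ (iSup_le h) hZ)

/-- If `M'` differed from every conjugate of `M`, it would commute with all of them modulo the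
quasi-center, hence with the whole residual, and so would be quasi-central. -/
theorem exists_conj_eq (hA : IsBurgerMozesAction A X) {M M' : Subgroup A}
    (hM : Minimal (IsAdmissible A) M) (hM' : Minimal (IsAdmissible A) M') :
    ∃ a : A, MulAut.conj a • M = M' := by
  by_contra! hne
  refine hM'.1.ne (le_antisymm (fun m hm => ?_) hM'.1.le)
  refine hA.mem_residualQuasiCenter_of_commutator hA.hasTrivialFixer_residualQuasiCenter
    (hM'.1.le_residual hm) ?_
  have hD := hA.normal_residualQuasiCenter
  -- The centralizer of `m` modulo the quasi-center of the residual; it is closed because that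
  -- quasi-center is.
  let Z : Subgroup A :=
    { carrier := {g | m * g * m⁻¹ * g⁻¹ ∈ residualQuasiCenter A}
      one_mem' := by simp
      mul_mem' := fun {g k} hg hk => by
        have := mul_mem hg (hD.conj_mem _ hk g)
        simpa [mul_assoc] using this
      inv_mem' := fun {g} hg => by
        have := hD.conj_mem _ (inv_mem hg) g⁻¹
        simpa [mul_assoc] using this }
  have hZ : IsClosed (Z : Set A) := hA.isClosed_residualQuasiCenter.preimage
    (f := fun g => m * g * m⁻¹ * g⁻¹) (by fun_prop)
  exact fun g hg => hA.le_of_forall_conj_le hM.1 hZ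
    (fun a n hn => commutator_mem_of_minimal hM' (hA.minimal_conj_smul hM a) (hne a).symm hm hn) hg

theorem normal_sSup_minimal (hA : IsBurgerMozesAction A X) :
    (sSup {M | Minimal (IsAdmissible A) M}).Normal := by
  rw [sSup_eq_iSup']
  refine ⟨fun n hn g => ?_⟩
  induction hn using Subgroup.iSup_induction' with
  | hp M n hn =>
    refine Subgroup.mem_iSup_of_mem ⟨_, hA.minimal_conj_smul M.2 g⟩ (mem_conj_iff.2 ?_)
    simpa [mul_assoc] using hn
  | h1 => simp
  | hmul x y _ _ hx hy => simpa [mul_assoc] using mul_mem hx hy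

theorem exists_minimal (hA : IsBurgerMozesAction A X) : ∃ M, Minimal (IsAdmissible A) M :=
  let ⟨M, _, h⟩ := hA.exists_minimal_le hA.isAdmissible_cocompactResidual
  ⟨M, h⟩

/-- The minimal subgroups generate a non-discrete normal subgroup, which contains a finitely
generated cofinite one. Its generators involve only finitely many minimal subgroups; any further one
would commute with it modulo a discrete group and so be discrete. -/
theorem finite_minimal (hA : IsBurgerMozesAction A X) :
    {M | Minimal (IsAdmissible A) M}.Finite := by
  obtain ⟨M₀, hM₀⟩ := hA.exists_minimal
  set P := sSup {M | Minimal (IsAdmissible A) M} with hP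
  have hnd : ¬ HasTrivialFixer X P := fun h =>
    hM₀.1.not_hasTrivialFixer hA (h.mono (le_sSup hM₀))
  obtain ⟨T, hT, hTP, F, hF, hTF⟩ := hA.isFinGenCofinite P hA.normal_sSup_minimal hnd
  have hex : ∀ t ∈ P, ∃ S : Set (Subgroup A), S.Finite ∧ S ⊆ {M | Minimal (IsAdmissible A) M} ∧
      t ∈ sSup S := by
    intro t ht
    rw [hP, sSup_eq_iSup'] at ht
    induction ht using Subgroup.iSup_induction' with
    | hp M n hn => exact ⟨{M.1}, Set.finite_singleton _, by simp [M.2], by simpa using hn⟩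
    | h1 => exact ⟨∅, Set.finite_empty, by simp, one_mem _⟩
    | hmul x y _ _ hx hy =>
      obtain ⟨S, hS, hSm, hxS⟩ := hx
      obtain ⟨S', hS', hSm', hyS⟩ := hy
      exact ⟨S ∪ S', hS.union hS', Set.union_subset hSm hSm',
        mul_mem ((sSup_le_sSup Set.subset_union_left : sSup S ≤ sSup (S ∪ S')) hxS)
          ((sSup_le_sSup Set.subset_union_right : sSup S' ≤ sSup (S ∪ S')) hyS)⟩
  choose! S hS hSm hSt using hex
  refine (hT.biUnion fun t ht => hS t (hTP ht)).subset fun M hM => ?_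
  by_contra hMS
  have hD := hA.normal_residualQuasiCenter
  have hcof : IsFinGenCofinite X (Subgroup.closure T) :=
    ⟨T, hT, Subgroup.subset_closure, F, hF, hTF⟩
  refine hM.1.not_hasTrivialFixer hA (hcof.hasTrivialFixer_of_commute hA.faithful fun n hn =>
    hA.hasTrivialFixer_residualQuasiCenter.exists_commute n fun c hc => ?_)
  let Z : Subgroup A :=
    { carrier := {g | c * g * c⁻¹ * g⁻¹ ∈ residualQuasiCenter A}
      one_mem' := by simp
      mul_mem' := fun {g k} hg hk => by
        have := mul_mem hg (hD.conj_mem _ hk g)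
        simpa [mul_assoc] using this
      inv_mem' := fun {g} hg => by
        have := hD.conj_mem _ (inv_mem hg) g⁻¹
        simpa [mul_assoc] using this }
  have hTZ : Subgroup.closure T ≤ Z := by
    rw [Subgroup.closure_le]
    intro t ht
    have : sSup (S t) ≤ Z := sSup_le fun M' hM' g hg =>
      commutator_mem_of_minimal hM (hSm t (hTP ht) hM')
        (fun h => hMS (Set.mem_biUnion ht (h ▸ hM'))) hc hg
    exact this (hSt t (hTP ht))
  have : (c * n * c⁻¹ * n⁻¹)⁻¹ ∈ residualQuasiCenter A := inv_mem (hTZ hn)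
  simpa [mul_assoc] using this

/-- The normalizer of `L` is closed and contains every conjugate of `M`: `M` by hypothesis, the
others because their commutators with `L` lie in the quasi-center, inside `L`. Hence `L` is normal
in the residual and minimality applies. -/
theorem eq_or_eq_of_minimal (hA : IsBurgerMozesAction A X) {M L : Subgroup A}
    (hM : Minimal (IsAdmissible A) M) (hDL : residualQuasiCenter A ≤ L) (hLM : L ≤ M)
    (hL : IsConjInvariant M L) (hcl : IsClosed (L : Set A)) :
    L = residualQuasiCenter A ∨ L = M := by
  by_cases hne : L = residualQuasiCenter A
  · exact Or.inl hne
  right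
  refine le_antisymm hLM (hM.2 ⟨hDL, hne, hLM.trans hM.1.le_residual, ?_, hcl⟩ hLM)
  let Z : Subgroup A :=
    { carrier := {g | ∀ n ∈ L, g * n * g⁻¹ ∈ L ∧ g⁻¹ * n * g ∈ L}
      one_mem' := by simp
      mul_mem' := fun {g k} hg hk n hn => by
        refine ⟨?_, ?_⟩
        · simpa [mul_assoc] using (hg _ (hk n hn).1).1
        · simpa [mul_assoc] using (hk _ (hg n hn).2).2
      inv_mem' := fun {g} hg n hn => by simpa using (hg n hn).symm }
  have hZ : IsClosed (Z : Set A) := by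
    have : (Z : Set A) = ⋂ n ∈ L, ((fun g => g * n * g⁻¹) ⁻¹' (L : Set A) ∩
        (fun g => g⁻¹ * n * g) ⁻¹' (L : Set A)) := by
      ext g
      simp only [Set.mem_iInter]
      rfl
    rw [this]
    exact isClosed_biInter fun n _ =>
      (hcl.preimage (by fun_prop)).inter (hcl.preimage (by fun_prop))
  have hle := hA.le_of_forall_conj_le hM.1 hZ fun a g hg n hn => by
    have hmin := hA.minimal_conj_smul hM a
    by_cases h : MulAut.conj a • M = M
    · rw [h] at hg
      exact ⟨hL g hg n hn, by simpa using hL g⁻¹ (inv_mem hg) n hn⟩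
    · refine ⟨?_, ?_⟩
      · simpa using mul_mem (hDL (commutator_mem_of_minimal hmin hM h hg (hLM hn))) hn
      · simpa using mul_mem (hDL (commutator_mem_of_minimal hmin hM h (inv_mem hg) (hLM hn))) hn
  exact fun g hg n hn => (hle hg n hn).1

end IsBurgerMozesAction

end ProfiniteActions

/-! ### Transfer to the quotient of the residual by its quasi-center. -/

section Subquotient

variable {A : Type u} {X : Type v} [Group A] [TopologicalSpace A] [IsTopologicalGroup A]
  [MulAction A X]

namespace BMSubquotient

theorem mem_preimage {M : Subgroup (BMSubquotient A)} {a : A} :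
    a ∈ preimage M ↔ ∃ h : a ∈ cocompactResidual A,
      QuotientGroup.mk' (quasiCenter (cocompactResidual A)) ⟨a, h⟩ ∈ M := by
  simp [preimage]

theorem coe_mem_preimage {M : Subgroup (BMSubquotient A)} (a : cocompactResidual A) :
    (a : A) ∈ preimage M ↔ QuotientGroup.mk' (quasiCenter (cocompactResidual A)) a ∈ M :=
  mem_preimage.trans ⟨fun h => h.2, fun h => ⟨a.2, h⟩⟩

theorem preimage_le_residual (M : Subgroup (BMSubquotient A)) :
    preimage M ≤ cocompactResidual A := fun _ ha => (mem_preimage.1 ha).1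

theorem preimage_le_preimage_iff {M M' : Subgroup (BMSubquotient A)} :
    preimage M ≤ preimage M' ↔ M ≤ M' := by
  refine ⟨fun h q hq => ?_, fun h a ha => ?_⟩
  · obtain ⟨a, rfl⟩ := QuotientGroup.mk'_surjective _ q
    exact (coe_mem_preimage a).1 (h ((coe_mem_preimage a).2 hq))
  · obtain ⟨h1, h2⟩ := mem_preimage.1 ha
    exact mem_preimage.2 ⟨h1, h h2⟩

theorem preimage_injective : Function.Injective (preimage (G := A)) := fun _ _ h =>
  le_antisymm (preimage_le_preimage_iff.1 h.le) (preimage_le_preimage_iff.1 h.ge)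

theorem preimage_bot : preimage (⊥ : Subgroup (BMSubquotient A)) = residualQuasiCenter A := by
  rw [preimage, residualQuasiCenter, MonoidHom.comap_bot, QuotientGroup.ker_mk']

theorem preimage_top : preimage (⊤ : Subgroup (BMSubquotient A)) = cocompactResidual A := by
  rw [preimage, Subgroup.comap_top, ← MonoidHom.range_eq_map, Subgroup.range_subtype]

theorem residualQuasiCenter_le_preimage (M : Subgroup (BMSubquotient A)) :
    residualQuasiCenter A ≤ preimage M := by
  rw [← preimage_bot]
  exact preimage_le_preimage_iff.2 bot_le

theorem exists_preimage_eq {N : Subgroup A} (hN : residualQuasiCenter A ≤ N)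
    (hN' : N ≤ cocompactResidual A) : ∃ M : Subgroup (BMSubquotient A), preimage M = N := by
  refine ⟨(N.subgroupOf (cocompactResidual A)).map (QuotientGroup.mk' _), ?_⟩
  rw [preimage, Subgroup.comap_map_eq, QuotientGroup.ker_mk', Subgroup.map_sup,
    Subgroup.map_subgroupOf_eq_of_le hN']
  exact sup_eq_left.2 hN

theorem isClosed_preimage_iff (M : Subgroup (BMSubquotient A)) :
    IsClosed (preimage M : Set A) ↔ IsClosed (M : Set (BMSubquotient A)) := by
  have h1 : IsClosed (M : Set (BMSubquotient A)) ↔ IsClosed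
      (M.comap (QuotientGroup.mk' (quasiCenter (cocompactResidual A))) :
        Set (cocompactResidual A)) :=
    (QuotientGroup.isQuotientMap_mk (N := quasiCenter (cocompactResidual A))
      |>.isClosed_preimage (s := (M : Set (BMSubquotient A)))).symm
  rw [h1, preimage, Subgroup.coe_map]
  exact (IsBurgerMozesAction.isClosed_cocompactResidual.isClosedEmbedding_subtypeVal
    |>.isClosed_iff_image_isClosed).symm

theorem isConjInvariant_preimage_iff (M M' : Subgroup (BMSubquotient A)) :
    IsConjInvariant (preimage M) (preimage M') ↔ IsConjInvariant M M' := by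
  constructor
  · intro h q hq n hn
    obtain ⟨a, rfl⟩ := QuotientGroup.mk'_surjective _ q
    obtain ⟨b, rfl⟩ := QuotientGroup.mk'_surjective _ n
    exact (coe_mem_preimage (a * b * a⁻¹)).1
      (h a ((coe_mem_preimage a).2 hq) b ((coe_mem_preimage b).2 hn))
  · intro h a ha b hb
    obtain ⟨h1, h2⟩ := mem_preimage.1 ha
    obtain ⟨h3, h4⟩ := mem_preimage.1 hb
    exact (coe_mem_preimage (⟨a, h1⟩ * ⟨b, h3⟩ * ⟨a, h1⟩⁻¹)).2 (h _ h2 _ h4)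

theorem isAdmissible_preimage_iff (M : Subgroup (BMSubquotient A)) :
    IsAdmissible A (preimage M) ↔
      M ≠ ⊥ ∧ M.Normal ∧ IsClosed (M : Set (BMSubquotient A)) := by
  have hconj : IsConjInvariant (cocompactResidual A) (preimage M) ↔ M.Normal := by
    refine (Iff.of_eq (congrArg (IsConjInvariant · (preimage M)) preimage_top.symm)).trans ?_
    rw [isConjInvariant_preimage_iff]
    exact ⟨fun h => ⟨fun n hn g => h g trivial n hn⟩, fun h g _ n hn => h.conj_mem n hn g⟩
  constructor
  · intro h
    refine ⟨?_, hconj.1 h.conj, (isClosed_preimage_iff M).1 h.isClosed⟩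
    rintro rfl
    exact h.ne preimage_bot
  · rintro ⟨h1, h2, h3⟩
    refine ⟨residualQuasiCenter_le_preimage M, fun h => h1 (preimage_injective ?_),
      preimage_le_residual M, hconj.2 h2, (isClosed_preimage_iff M).2 h3⟩
    rw [h, preimage_bot]

theorem mem_minimalClosedNormalSubgroups_iff (M : Subgroup (BMSubquotient A)) :
    M ∈ minimalClosedNormalSubgroups (BMSubquotient A) ↔ Minimal (IsAdmissible A) (preimage M) := by
  constructor
  · intro h
    refine ⟨(isAdmissible_preimage_iff M).2 h.1, fun N hN hle => ?_⟩
    obtain ⟨K, rfl⟩ := exists_preimage_eq hN.le hN.le_residual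
    exact preimage_le_preimage_iff.2
      (h.2 ((isAdmissible_preimage_iff K).1 hN) (preimage_le_preimage_iff.1 hle))
  · intro h
    refine ⟨(isAdmissible_preimage_iff M).1 h.1, fun K hK hle => ?_⟩
    exact preimage_le_preimage_iff.1
      (h.2 ((isAdmissible_preimage_iff K).2 hK) (preimage_le_preimage_iff.2 hle))

end BMSubquotient

namespace IsBurgerMozesAction

open BMSubquotient

theorem minimalClosedNormalSubgroups_nonempty (hA : IsBurgerMozesAction A X) :
    (minimalClosedNormalSubgroups (BMSubquotient A)).Nonempty := by
  obtain ⟨N, hN⟩ := hA.exists_minimal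
  obtain ⟨M, rfl⟩ := exists_preimage_eq hN.1.le hN.1.le_residual
  exact ⟨M, (mem_minimalClosedNormalSubgroups_iff M).2 hN⟩

theorem minimalClosedNormalSubgroups_finite (hA : IsBurgerMozesAction A X) :
    (minimalClosedNormalSubgroups (BMSubquotient A)).Finite := by
  have : minimalClosedNormalSubgroups (BMSubquotient A) =
      preimage ⁻¹' {N | Minimal (IsAdmissible A) N} := by
    ext M
    exact mem_minimalClosedNormalSubgroups_iff M
  rw [this]
  exact hA.finite_minimal.preimage preimage_injective.injOn

theorem areConjugate_of_minimal (hA : IsBurgerMozesAction A X) {M M' : Subgroup (BMSubquotient A)}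
    (hM : M ∈ minimalClosedNormalSubgroups (BMSubquotient A))
    (hM' : M' ∈ minimalClosedNormalSubgroups (BMSubquotient A)) : AreConjugate M M' :=
  hA.exists_conj_eq ((mem_minimalClosedNormalSubgroups_iff M).1 hM)
    ((mem_minimalClosedNormalSubgroups_iff M').1 hM')

/-- A closed normal subgroup of `M` pulls back to a group invariant only under the preimage of `M`,
which is exactly what `eq_or_eq_of_minimal` handles. -/
theorem isTopologicallySimple_of_minimal (hA : IsBurgerMozesAction A X)
    {M : Subgroup (BMSubquotient A)}
    (hM : M ∈ minimalClosedNormalSubgroups (BMSubquotient A)) : IsTopologicallySimple M := by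
  refine ⟨(Subgroup.nontrivial_iff_ne_bot M).2 hM.1.1, fun N hN hcl => ?_⟩
  have hle : N.map M.subtype ≤ M := Subgroup.map_subtype_le N
  have hinv : IsConjInvariant M (N.map M.subtype) := by
    rintro g hg _ ⟨n, hn, rfl⟩
    exact ⟨⟨g, hg⟩ * n * ⟨g, hg⟩⁻¹, hN.conj_mem n hn ⟨g, hg⟩, rfl⟩
  have hcl' : IsClosed (N.map M.subtype : Set (BMSubquotient A)) := by
    rw [Subgroup.coe_map]
    exact (hM.1.2.2.isClosedEmbedding_subtypeVal.isClosed_iff_image_isClosed).1 hcl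
  have h := hA.eq_or_eq_of_minimal ((mem_minimalClosedNormalSubgroups_iff M).1 hM)
    (residualQuasiCenter_le_preimage (N.map M.subtype)) (preimage_le_preimage_iff.2 hle)
    ((isConjInvariant_preimage_iff _ _).2 hinv) ((isClosed_preimage_iff _).2 hcl')
  rw [← preimage_bot] at h
  rcases h with h | h
  · left
    exact (Subgroup.map_eq_bot_iff_of_injective N M.subtype_injective).1 (preimage_injective h)
  · right
    have h' := preimage_injective h
    rw [eq_top_iff]
    intro m _
    have hm : (m : BMSubquotient A) ∈ N.map M.subtype := by rw [h']; exact m.2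
    obtain ⟨n, hn, hnm⟩ := hm
    rwa [← Subtype.ext hnm]

end IsBurgerMozesAction

/-! ### Direct product decomposition as topological groups. -/

/-- If finitely many closed topologically simple subgroups commute pairwise, generate the group,
and the center is trivial, the group is their direct product. -/
theorem isDirectProductOfTopologicallySimple_of_iSup_eq_top {Q : Type u} [Group Q]
    [TopologicalSpace Q] [IsTopologicalGroup Q] [T2Space Q] [LocallyCompactSpace Q]
    [SigmaCompactSpace Q] {n : ℕ} (S : Fin n → Subgroup Q)
    (hS : ∀ i, IsTopologicallySimple (S i)) (hcl : ∀ i, IsClosed (S i : Set Q))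
    (hcomm : Pairwise fun i j => ∀ x y : Q, x ∈ S i → y ∈ S j → Commute x y)
    (hsup : ⨆ i, S i = ⊤) (hcenter : ∀ z : Q, (∀ g, Commute z g) → z = 1) :
    IsDirectProductOfTopologicallySimple Q := by
  -- An element of `S i` lying also in the join of the other factors commutes with every factor,
  -- hence is central and trivial.
  have hindep : iSupIndep S := by
    intro i
    rw [Subgroup.disjoint_def]
    intro x hx hx'
    refine hcenter x fun g => ?_
    have hg : g ∈ ⨆ i, S i := by rw [hsup]; trivial
    have hle : ⨆ i, S i ≤ Subgroup.centralizer {x} := by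
      refine iSup_le fun j y hy => Subgroup.mem_centralizer_singleton_iff.2 ?_
      by_cases hij : i = j
      · subst hij
        have : ⨆ k, ⨆ _ : k ≠ i, S k ≤ Subgroup.centralizer {y} :=
          iSup₂_le fun k hk z hz => Subgroup.mem_centralizer_singleton_iff.2
            (hcomm hk z y hz hy).eq
        exact (Subgroup.mem_centralizer_singleton_iff.1 (this hx')).symm
      · exact (hcomm hij x y hx hy).symm.eq
    exact (Subgroup.mem_centralizer_singleton_iff.1 (hle hg)).symm
  let φ : ((i : Fin n) → S i) →* Q := Subgroup.noncommPiCoprod hcomm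
  have hinj : Function.Injective φ := Subgroup.injective_noncommPiCoprod_of_iSupIndep hindep
  have hsurj : Function.Surjective φ := by
    rw [← MonoidHom.range_eq_top, ← hsup]
    exact Subgroup.noncommPiCoprod_range
  have hcont : Continuous φ := by
    have key : ∀ s : Finset (Fin n), Continuous fun f : (i : Fin n) → S i =>
        s.noncommProd (fun i => (f i : Q)) fun i _ j _ hij => hcomm hij _ _ (f i).2 (f j).2 := by
      intro s
      induction s using Finset.induction_on with
      | empty => exact continuous_const (y := (1 : Q))
      | insert a s ha ih =>
        exact ((continuous_subtype_val.comp (continuous_apply a)).mul ih).congr fun f =>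
          (Finset.noncommProd_insert_of_notMem s a (fun i => (f i : Q)) _ ha).symm
    exact key Finset.univ
  have : ∀ i, SigmaCompactSpace (S i) := fun i =>
    (hcl i).isClosedEmbedding_subtypeVal.sigmaCompactSpace
  -- Open mapping theorem: σ-compact source, locally compact Hausdorff target.
  have hopen : IsOpenMap φ := φ.isOpenMap_of_sigmaCompact hsurj hcont
  let e : ((i : Fin n) → S i) ≃* Q := MulEquiv.ofBijective φ ⟨hinj, hsurj⟩
  let h : ((i : Fin n) → S i) ≃ₜ Q := e.toEquiv.toHomeomorphOfContinuousOpen hcont hopen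
  exact ⟨n, S, hS, ⟨(ContinuousMulEquiv.mk e h.continuous_toFun h.continuous_invFun).symm⟩⟩

/-- A finitely generated group is countable and has finitely many orbits here. Countability of `X`
gives the σ-compactness needed for the open mapping theorem. -/
theorem IsFinGenCofinite.countable {N : Subgroup A} (hN : IsFinGenCofinite X N) :
    Countable X := by
  obtain ⟨T, hT, -, F, hF, h⟩ := hN
  have : Countable T := hT.countable
  have : Countable F := hF.countable
  have : Countable (FreeGroup T) := Quot.mk_surjective.countable
  have : Countable (Subgroup.closure T) := by
    rw [FreeGroup.closure_eq_range]
    exact (FreeGroup.lift (fun t : T => (t : A))).rangeRestrict_surjective.countable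
  have : Function.Surjective fun p : Subgroup.closure T × F => (p.1 : A) • (p.2 : X) := fun x =>
    let ⟨g, hg, f, hf, hx⟩ := h x
    ⟨(⟨g, hg⟩, ⟨f, hf⟩), hx⟩
  exact this.countable

theorem IsProfiniteAction.sigmaCompactSpace (hA : IsProfiniteAction A X) [Countable X]
    [Nonempty X] : SigmaCompactSpace A := by
  obtain ⟨x₀⟩ := ‹Nonempty X›
  refine SigmaCompactSpace.of_countable (Set.range fun y : X => {a : A | a • x₀ = y})
    (Set.countable_range _) ?_ ?_
  · rintro _ ⟨y, rfl⟩
    by_cases hy : ∃ b : A, b • x₀ = y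
    · obtain ⟨b, rfl⟩ := hy
      convert (hA.isCompact_stabilizer x₀).image (continuous_const_mul b) using 1
      ext a
      rw [Set.mem_image]
      refine ⟨fun ha => ⟨b⁻¹ * a, ?_, by group⟩, ?_⟩
      · rw [SetLike.mem_coe, MulAction.mem_stabilizer_iff, mul_smul, inv_smul_eq_iff]
        exact ha
      · rintro ⟨s, hs, rfl⟩
        change (b * s) • x₀ = b • x₀
        rw [mul_smul, MulAction.mem_stabilizer_iff.1 hs]
    · convert isCompact_empty
      exact Set.eq_empty_of_forall_notMem fun a ha => hy ⟨a, ha⟩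
  · exact Set.eq_univ_of_forall fun a => ⟨_, ⟨a • x₀, rfl⟩, rfl⟩

/-- The hypothesis `h` asks for generation without closure; it is the one ingredient that the
abstract theory does not provide. The center of the quotient is trivial since an element central
modulo a discrete group is quasi-central. -/
theorem IsBurgerMozesAction.isDirectProductOfTopologicallySimple (hA : IsBurgerMozesAction A X)
    (h : cocompactResidual A ≤ sSup {M | Minimal (IsAdmissible A) M}) :
    IsDirectProductOfTopologicallySimple (BMSubquotient A) := by
  have := hA.t2Space
  have := hA.nonempty
  have := hA.isFinGenCofinite_cocompactResidual.countable
  have := hA.sigmaCompactSpace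
  obtain ⟨x₀⟩ := hA.nonempty
  have : LocallyCompactSpace A :=
    (hA.isCompact_stabilizer x₀).locallyCompactSpace_of_mem_nhds_of_group
      ((hA.isOpen_stabilizer x₀).mem_nhds (one_mem _))
  have hGcl : Topology.IsClosedEmbedding (Subtype.val : cocompactResidual A → A) :=
    IsBurgerMozesAction.isClosed_cocompactResidual.isClosedEmbedding_subtypeVal
  have := hGcl.sigmaCompactSpace
  have := hGcl.locallyCompactSpace
  have hcl : IsClosed (quasiCenter (cocompactResidual A) : Set (cocompactResidual A)) := by
    rw [hGcl.isClosed_iff_image_isClosed]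
    exact hA.isClosed_residualQuasiCenter
  have : SigmaCompactSpace (BMSubquotient A) := by
    have h2 := isSigmaCompact_univ.image (f := QuotientGroup.mk' (quasiCenter (cocompactResidual A)))
      continuous_quot_mk
    rw [Set.image_univ, (QuotientGroup.mk'_surjective _).range_eq] at h2
    exact isSigmaCompact_univ_iff.1 h2
  have := hA.minimalClosedNormalSubgroups_finite.to_subtype
  obtain ⟨n, ⟨e⟩⟩ := Finite.exists_equiv_fin (minimalClosedNormalSubgroups (BMSubquotient A))
  have hmin : ∀ i, ((e.symm i : minimalClosedNormalSubgroups (BMSubquotient A)) :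
      Subgroup (BMSubquotient A)) ∈ minimalClosedNormalSubgroups (BMSubquotient A) :=
    fun i => (e.symm i).2
  have hone : ∀ a : cocompactResidual A, (a : A) ∈ residualQuasiCenter A →
      QuotientGroup.mk' (quasiCenter (cocompactResidual A)) a = 1 := by
    intro a ha
    rw [← BMSubquotient.preimage_bot, BMSubquotient.coe_mem_preimage] at ha
    exact ha
  refine isDirectProductOfTopologicallySimple_of_iSup_eq_top
    (fun i => ((e.symm i : minimalClosedNormalSubgroups (BMSubquotient A)) :
      Subgroup (BMSubquotient A)))
    (fun i => hA.isTopologicallySimple_of_minimal (hmin i)) (fun i => (hmin i).1.2.2) ?_ ?_ ?_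
  · intro i j hij x y hx hy
    obtain ⟨a, rfl⟩ := QuotientGroup.mk'_surjective _ x
    obtain ⟨b, rfl⟩ := QuotientGroup.mk'_surjective _ y
    have h1 := commutator_mem_of_minimal
      ((BMSubquotient.mem_minimalClosedNormalSubgroups_iff _).1 (hmin i))
      ((BMSubquotient.mem_minimalClosedNormalSubgroups_iff _).1 (hmin j))
      (fun h => hij (e.symm.injective (Subtype.ext (BMSubquotient.preimage_injective h))))
      ((BMSubquotient.coe_mem_preimage a).2 hx) ((BMSubquotient.coe_mem_preimage b).2 hy)
    have h2 := hone (a * b * a⁻¹ * b⁻¹) h1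
    rw [map_mul, map_mul, map_mul, map_inv, map_inv] at h2
    rwa [← commutatorElement_def, commutatorElement_eq_one_iff_commute] at h2
  · rw [eq_top_iff]
    intro q _
    obtain ⟨a, rfl⟩ := QuotientGroup.mk'_surjective _ q
    refine (BMSubquotient.coe_mem_preimage a).1 ((h.trans (sSup_le fun N hN => ?_)) a.2)
    obtain ⟨M, rfl⟩ := BMSubquotient.exists_preimage_eq hN.1.le hN.1.le_residual
    rw [BMSubquotient.preimage_le_preimage_iff]
    refine le_trans (le_of_eq ?_) (le_iSup _
      (e ⟨M, (BMSubquotient.mem_minimalClosedNormalSubgroups_iff M).2 hN⟩))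
    simp
  · intro z hz
    obtain ⟨a, rfl⟩ := QuotientGroup.mk'_surjective _ z
    refine hone a (hA.mem_residualQuasiCenter_of_commutator hA.hasTrivialFixer_residualQuasiCenter
      a.2 fun g hg => ?_)
    rw [← BMSubquotient.preimage_bot]
    refine (BMSubquotient.coe_mem_preimage (a * ⟨g, hg⟩ * a⁻¹ * ⟨g, hg⟩⁻¹)).2 ?_
    rw [map_mul, map_mul, map_mul, map_inv, map_inv, Subgroup.mem_bot, ← commutatorElement_def,
      commutatorElement_eq_one_iff_commute]
    exact hz _

end Subquotient

/-! ### Locally transitive actions on graphs and the discrete-or-cofinite dichotomy. -/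

namespace SerreGraph

variable {V : Type u} {E : Type v} (Γ : SerreGraph V E)

/-- Actions of a group on a graph by automorphisms. -/
structure IsGraphAction (A : Type w) [Group A] [MulAction A V] [MulAction A E] : Prop where
  o_smul : ∀ (a : A) (e : E), Γ.o (a • e) = a • Γ.o e
  t_smul : ∀ (a : A) (e : E), Γ.t (a • e) = a • Γ.t e
  bar_smul : ∀ (a : A) (e : E), Γ.bar (a • e) = a • Γ.bar e

/-- The subgroup `N` permutes transitively the edges issuing from `z`. -/
def IsStarTransitive {A : Type w} [Group A] [MulAction A E] (N : Subgroup A) (z : V) : Prop :=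
  ∀ e f : E, Γ.o e = z → Γ.o f = z → ∃ n ∈ N, n • e = f

/-- The subgroup `N` acts semiregularly on the edges issuing from `z`. -/
def IsStarSemiregular {A : Type w} [Group A] [MulAction A E] (N : Subgroup A) (z : V) : Prop :=
  ∀ n ∈ N, ∀ e f : E, Γ.o e = z → Γ.o f = z → n • e = e → n • f = f

variable {Γ} {A : Type w} [Group A] [MulAction A V] [MulAction A E]

/-- The union of the `R`-translates of `S` is closed under passing to neighbours, so it is
everything by connectedness. -/
theorem IsConnected.exists_smul_eq (hconn : Γ.IsConnected) (hA : Γ.IsGraphAction A)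
    {R : Subgroup A} {S : Set V} (hS : S.Nonempty)
    (h : ∀ s ∈ S, ∀ e, Γ.o e = s → ∃ r ∈ R, ∃ s' ∈ S, r • s' = Γ.t e) (v : V) :
    ∃ r ∈ R, ∃ s ∈ S, r • s = v := by
  obtain ⟨s₀, hs₀⟩ := hS
  induction hconn s₀ v with
  | refl => exact ⟨1, R.one_mem, s₀, hs₀, one_smul _ _⟩
  | tail _ hstep ih =>
    obtain ⟨r, hr, s, hs, rfl⟩ := ih
    obtain ⟨e, he, rfl⟩ := hstep
    obtain ⟨r', hr', s', hs', h'⟩ := h s hs (r⁻¹ • e) (by rw [hA.o_smul, he, inv_smul_smul])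
    refine ⟨r * r', R.mul_mem hr hr', s', hs', ?_⟩
    rw [mul_smul, h', hA.t_smul, smul_inv_smul]

/-- An automorphism fixes everything if fixing an edge forces it to fix the adjacent edges. -/
theorem IsConnected.smul_eq_of_fixes_star (hconn : Γ.IsConnected) (hA : Γ.IsGraphAction A) {n : A}
    (hn : ∀ e f, Γ.o e = Γ.o f → n • e = e → n • f = f) {e₀ : E} (he₀ : n • e₀ = e₀) :
    (∀ v : V, n • v = v) ∧ ∀ e : E, n • e = e := by
  have key : ∀ v : V, n • v = v ∧ ∀ f, Γ.o f = v → n • f = f := by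
    intro v
    induction hconn (Γ.o e₀) v with
    | refl => exact ⟨by rw [← hA.o_smul, he₀], fun f hf => hn e₀ f hf.symm he₀⟩
    | tail _ hstep ih =>
      obtain ⟨e, he, rfl⟩ := hstep
      have hne := ih.2 e he
      refine ⟨by rw [← hA.t_smul, hne], fun f hf => hn (Γ.bar e) f ?_ ?_⟩
      · rw [Γ.o_bar, hf]
      · rw [← hA.bar_smul, hne]
  exact ⟨fun v => (key v).1, fun e => (key _).2 e rfl⟩

theorem IsConnected.exists_smul_ends (hconn : Γ.IsConnected) (hA : Γ.IsGraphAction A)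
    (htrans : ∀ z, Γ.IsStarTransitive (⊤ : Subgroup A) z) (e : E) (v : V) :
    ∃ a : A, a • Γ.o e = v ∨ a • Γ.t e = v := by
  obtain ⟨a, -, s, hs, rfl⟩ := hconn.exists_smul_eq hA (R := (⊤ : Subgroup A))
    (S := {Γ.o e, Γ.t e}) ⟨_, Or.inl rfl⟩ (by
      rintro s (rfl | rfl) f hf
      · obtain ⟨a, -, rfl⟩ := htrans _ e f rfl hf
        exact ⟨a, trivial, Γ.t e, Or.inr rfl, (hA.t_smul _ _).symm⟩
      · obtain ⟨a, -, rfl⟩ := htrans _ (Γ.bar e) f (Γ.o_bar e) hf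
        exact ⟨a, trivial, Γ.o e, Or.inl rfl, by rw [hA.t_smul, Γ.t_bar]⟩) v
  rcases hs with rfl | rfl
  · exact ⟨a, Or.inl rfl⟩
  · exact ⟨a, Or.inr rfl⟩

theorem IsConnected.exists_smul_edge (hconn : Γ.IsConnected) (hA : Γ.IsGraphAction A)
    (htrans : ∀ z, Γ.IsStarTransitive (⊤ : Subgroup A) z) (e f : E) :
    ∃ a : A, a • e = f ∨ a • Γ.bar e = f := by
  obtain ⟨a, ha | ha⟩ := hconn.exists_smul_ends hA htrans e (Γ.o f)
  · obtain ⟨b, -, hb⟩ := htrans (Γ.o f) (a • e) f (by rw [hA.o_smul, ha]) rfl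
    exact ⟨b * a, Or.inl (by rw [mul_smul, hb])⟩
  · obtain ⟨b, -, hb⟩ := htrans (Γ.o f) (a • Γ.bar e) f (by rw [hA.o_smul, Γ.o_bar, ha]) rfl
    exact ⟨b * a, Or.inr (by rw [mul_smul, hb])⟩

/-- A subgroup with finitely many orbits of vertices contains a finitely generated subgroup with
finitely many orbits. -/
theorem IsConnected.isFinGenCofinite (hconn : Γ.IsConnected) (hfin : Γ.IsLocallyFinite)
    (hA : Γ.IsGraphAction A) {N : Subgroup A} {S : Set V} (hS : S.Finite) (hSn : S.Nonempty)
    (h : ∀ v, ∃ n ∈ N, ∃ s ∈ S, n • s = v) : IsFinGenCofinite (V ⊕ E) N := by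
  choose n hn s hs hns using h
  set B : Set E := ⋃ s ∈ S, Γ.star s with hB
  have hBf : B.Finite := hS.biUnion fun s _ => hfin s
  refine ⟨(fun e => n (Γ.t e)) '' B, hBf.image _, ?_, Sum.inl '' S ∪ Sum.inr '' B,
    (hS.image _).union (hBf.image _), ?_⟩
  · rintro _ ⟨e, _, rfl⟩
    exact hn _
  -- One generator for each edge `e` leaving `S`, chosen to carry a point of `S` to the far end of
  -- `e`; finitely many by local finiteness.
  have hV : ∀ v, ∃ r ∈ Subgroup.closure ((fun e => n (Γ.t e)) '' B), ∃ s ∈ S, r • s = v :=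
    hconn.exists_smul_eq hA hSn fun s₁ hs₁ e he =>
      ⟨n (Γ.t e), Subgroup.subset_closure ⟨e, Set.mem_biUnion hs₁ he, rfl⟩, s (Γ.t e), hs _, hns _⟩
  rintro (v | e)
  · obtain ⟨r, hr, s₁, hs₁, rfl⟩ := hV v
    exact ⟨r, hr, Sum.inl s₁, Or.inl ⟨s₁, hs₁, rfl⟩, rfl⟩
  · obtain ⟨r, hr, s₁, hs₁, hrs⟩ := hV (Γ.o e)
    refine ⟨r, hr, Sum.inr (r⁻¹ • e), Or.inr ⟨_, Set.mem_biUnion hs₁ ?_, rfl⟩, ?_⟩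
    · change Γ.o (r⁻¹ • e) = s₁
      rw [hA.o_smul, ← hrs, inv_smul_smul]
    · rw [Sum.smul_inr, smul_inv_smul]

/-- With `U` the open subgroup fixing both ends of `e₀`, compactness gives `A = N F U` with `F`
finite. Every vertex is a translate of an end of `e₀`, so `N` has finitely many vertex orbits. -/
theorem IsConnected.isFinGenCofinite_of_compactSpace [TopologicalSpace A] [IsTopologicalGroup A]
    (hconn : Γ.IsConnected) (hfin : Γ.IsLocallyFinite) (hA : Γ.IsGraphAction A)
    (hP : IsProfiniteAction A (V ⊕ E))
    (htrans : ∀ z, Γ.IsStarTransitive (⊤ : Subgroup A) z) (e₀ : E) {N : Subgroup A}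
    (hN : N.Normal) (hc : CompactSpace (A ⧸ N)) : IsFinGenCofinite (V ⊕ E) N := by
  set U : Subgroup A := MulAction.stabilizer A (Sum.inl (Γ.o e₀) : V ⊕ E) ⊓
    MulAction.stabilizer A (Sum.inl (Γ.t e₀) : V ⊕ E) with hU
  have hUo : IsOpen (U : Set A) := (hP.isOpen_stabilizer _).inter (hP.isOpen_stabilizer _)
  have hUfix : ∀ u ∈ U, u • Γ.o e₀ = Γ.o e₀ ∧ u • Γ.t e₀ = Γ.t e₀ := by
    rintro u ⟨h1, h2⟩
    exact ⟨Sum.inl_injective h1, Sum.inl_injective h2⟩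
  obtain ⟨F, hF⟩ := isCompact_univ.elim_finite_subcover
    (fun a : A => (QuotientGroup.mk : A → A ⧸ N) '' ((fun u => a * u) '' (U : Set A)))
    (fun a => QuotientGroup.isOpenMap_coe _ ((isOpenMap_mul_left a) _ hUo))
    (fun q _ => by
      obtain ⟨a, rfl⟩ := QuotientGroup.mk_surjective q
      exact Set.mem_iUnion.2 ⟨a, a, ⟨1, U.one_mem, mul_one a⟩, rfl⟩)
  have hcov : ∀ b : A, ∃ a ∈ F, ∃ n ∈ N, ∃ u ∈ U, b = n * (a * u) := by
    intro b
    obtain ⟨a, ha, _, ⟨u, hu, rfl⟩, hb⟩ := Set.mem_iUnion₂.1 (hF (Set.mem_univ (b : A ⧸ N)))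
    refine ⟨a, ha, _, hN.conj_mem _ (QuotientGroup.eq.1 hb) (a * u), u, hu, by group⟩
  have hmem : ∀ a ∈ F, ∀ v, v = Γ.o e₀ ∨ v = Γ.t e₀ →
      a • v ∈ insert (Γ.o e₀) (⋃ a ∈ F, {a • Γ.o e₀, a • Γ.t e₀} : Set V) := by
    rintro a ha v (rfl | rfl)
    · exact Or.inr (Set.mem_biUnion ha (Or.inl rfl))
    · exact Or.inr (Set.mem_biUnion ha (Or.inr rfl))
  refine hconn.isFinGenCofinite hfin hA
    (S := insert (Γ.o e₀) (⋃ a ∈ F, {a • Γ.o e₀, a • Γ.t e₀}))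
    ((F.finite_toSet.biUnion fun a _ => Set.toFinite _).insert _) ⟨_, Set.mem_insert _ _⟩
    fun v => ?_
  obtain ⟨b, hb⟩ := hconn.exists_smul_ends hA htrans e₀ v
  obtain ⟨a, ha, n, hn, u, hu, rfl⟩ := hcov b
  rcases hb with rfl | rfl
  · exact ⟨n, hn, _, hmem a ha _ (Or.inl rfl), by rw [mul_smul, mul_smul, (hUfix u hu).1]⟩
  · exact ⟨n, hn, _, hmem a ha _ (Or.inr rfl), by rw [mul_smul, mul_smul, (hUfix u hu).2]⟩

/-- A normal subgroup of a locally transitive group acting transitively on a star is cofinite. -/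
theorem IsConnected.isFinGenCofinite_of_isStarTransitive (hconn : Γ.IsConnected)
    (hfin : Γ.IsLocallyFinite) (hA : Γ.IsGraphAction A)
    (htrans : ∀ z, Γ.IsStarTransitive (⊤ : Subgroup A) z) {N : Subgroup A}
    (hN : N.Normal) {e₀ : E} (h : Γ.IsStarTransitive N (Γ.t e₀)) :
    IsFinGenCofinite (V ⊕ E) N := by
  -- Some element of `A` carries `e₀` to `e` and normalizes `N`, so transitivity passes to the stars
  -- of all neighbours of `Γ.o e₀`.
  have hstar : ∀ e, Γ.o e = Γ.o e₀ → Γ.IsStarTransitive N (Γ.t e) := by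
    intro e he f f' hf hf'
    obtain ⟨a, -, rfl⟩ := htrans _ e₀ e rfl he
    obtain ⟨n, hn, hnf⟩ := h (a⁻¹ • f) (a⁻¹ • f') (by rw [hA.o_smul, hf, hA.t_smul, inv_smul_smul])
      (by rw [hA.o_smul, hf', hA.t_smul, inv_smul_smul])
    refine ⟨a * n * a⁻¹, hN.conj_mem n hn a, ?_⟩
    rw [mul_smul, mul_smul, hnf, smul_inv_smul]
  refine hconn.isFinGenCofinite hfin hA (S := insert (Γ.o e₀) (Γ.t '' Γ.star (Γ.o e₀)))
    (((hfin _).image _).insert _) ⟨_, Set.mem_insert _ _⟩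
    (hconn.exists_smul_eq hA ⟨_, Set.mem_insert _ _⟩ ?_)
  rintro s (rfl | ⟨e, he, rfl⟩) f hf
  · exact ⟨1, N.one_mem, Γ.t f, Or.inr ⟨f, hf, rfl⟩, one_smul _ _⟩
  -- Moving `Γ.bar e` onto `f` moves `Γ.o e₀` onto the far end of `f`: one step beyond the ball is
  -- still in the orbit of its center.
  · obtain ⟨n, hn, rfl⟩ := hstar e he (Γ.bar e) f (Γ.o_bar e) hf
    exact ⟨n, hn, Γ.o e₀, Or.inl rfl, by rw [hA.t_smul, Γ.t_bar, he]⟩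

theorem IsConnected.nonempty_edge [TopologicalSpace A] (hconn : Γ.IsConnected)
    (hP : IsProfiniteAction A (V ⊕ E)) (hnd : ¬ HasTrivialFixer (V ⊕ E) (⊤ : Subgroup A)) :
    Nonempty E := by
  by_contra hE
  rw [not_nonempty_iff] at hE
  refine hnd ⟨∅, Set.finite_empty, fun g _ _ => hP.faithful g ?_⟩
  rintro (v | e)
  · have : g • v = v := by
      rcases Relation.ReflTransGen.cases_head (hconn v (g • v)) with h | ⟨_, ⟨e, -⟩, -⟩
      · exact h.symm
      · exact hE.elim e
    rw [Sum.smul_inl, this]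
  · exact hE.elim e

/-- If `N` is transitive on the star at either end of `e₀`, it is cofinite. Otherwise it is
semiregular at both ends, hence by conjugation at all vertices, and an element fixing `e₀` fixes the
whole connected graph. -/
theorem IsConnected.isBurgerMozesAction [TopologicalSpace A] [IsTopologicalGroup A]
    (hconn : Γ.IsConnected) (hfin : Γ.IsLocallyFinite) (hA : Γ.IsGraphAction A)
    (hP : IsProfiniteAction A (V ⊕ E)) (hnd : ¬ DiscreteTopology A)
    (htrans : ∀ z, Γ.IsStarTransitive (⊤ : Subgroup A) z)
    (hsemi : ∀ N : Subgroup A, N.Normal → ∀ z, Γ.IsStarTransitive N z ∨ Γ.IsStarSemiregular N z) :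
    IsBurgerMozesAction A (V ⊕ E) := by
  have hnd' : ¬ HasTrivialFixer (V ⊕ E) (⊤ : Subgroup A) := fun h => hnd <| by
    have := (hP.hasTrivialFixer_iff _).1 h
    exact Topology.IsEmbedding.discreteTopology
      (Homeomorph.Set.univ A).symm.isEmbedding
  obtain ⟨e₀⟩ := hconn.nonempty_edge hP hnd'
  refine ⟨hP, hnd', fun N hN hNd => ?_, fun N hN hc =>
    hconn.isFinGenCofinite_of_compactSpace hfin hA hP htrans e₀ hN hc⟩
  rcases hsemi N hN (Γ.t e₀) with h1 | h1
  · exact hconn.isFinGenCofinite_of_isStarTransitive hfin hA htrans hN h1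
  rcases hsemi N hN (Γ.o e₀) with h2 | h2
  · exact hconn.isFinGenCofinite_of_isStarTransitive hfin hA htrans hN (e₀ := Γ.bar e₀)
      (by rwa [Γ.t_bar])
  exfalso
  have hall : ∀ z, Γ.IsStarSemiregular N z := by
    intro z n hn e f he hf hne
    have key : ∀ s, Γ.IsStarSemiregular N s → ∀ a : A, a • s = z → n • f = f := by
      intro s hs a ha
      have := hs (a⁻¹ * n * a) (by simpa using hN.conj_mem n hn a⁻¹) (a⁻¹ • e) (a⁻¹ • f)
        (by rw [hA.o_smul, he, ← ha, inv_smul_smul]) (by rw [hA.o_smul, hf, ← ha, inv_smul_smul])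
        (by rw [mul_smul, mul_smul, smul_inv_smul, hne])
      rwa [mul_smul, mul_smul, smul_inv_smul, smul_left_cancel_iff] at this
    obtain ⟨a, ha | ha⟩ := hconn.exists_smul_ends hA htrans e₀ z
    · exact key _ h2 a ha
    · exact key _ h1 a ha
  refine hNd ⟨{Sum.inr e₀}, Set.finite_singleton _, fun n hn hfix => hP.faithful n ?_⟩
  have h := hconn.smul_eq_of_fixes_star hA (n := n)
    (fun e f hef => hall (Γ.o f) n hn e f hef rfl) (e₀ := e₀)
    (Sum.inr_injective (hfix _ rfl))
  rintro (v | e)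
  · rw [Sum.smul_inl, h.1]
  · rw [Sum.smul_inr, h.2]

end SerreGraph

/-! ### The automorphism group of a locally finite connected graph acts profinitely. -/

namespace SerreGraph

variable {V : Type u} {E : Type v} {Γ : SerreGraph V E}

theorem isGraphAction_aut : Γ.IsGraphAction Γ.Aut where
  o_smul a e := (a.2.1 e).symm
  t_smul a e := (a.2.2.1 e).symm
  bar_smul a e := (a.2.2.2 e).symm

theorem IsGraphAction.subgroup {A : Type w} [Group A] [MulAction A V] [MulAction A E]
    (hA : Γ.IsGraphAction A) (H : Subgroup A) : Γ.IsGraphAction H where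
  o_smul a e := hA.o_smul a.1 e
  t_smul a e := hA.t_smul a.1 e
  bar_smul a e := hA.bar_smul a.1 e

theorem finite_orbit_stabilizer (hfin : Γ.IsLocallyFinite) (hconn : Γ.IsConnected) (x : V) :
    ∀ y : V ⊕ E, {z | ∃ g : Γ.Aut, g • x = x ∧ g • y = z}.Finite := by
  have hV : ∀ v : V, {z | ∃ g : Γ.Aut, g • x = x ∧ g • v = z}.Finite := by
    intro v
    induction hconn x v with
    | refl =>
      refine (Set.finite_singleton x).subset ?_
      rintro _ ⟨g, h1, rfl⟩
      exact h1
    | tail _ hstep ih =>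
      obtain ⟨e, rfl, rfl⟩ := hstep
      refine ((ih.biUnion fun w _ => hfin w).image Γ.t).subset ?_
      rintro _ ⟨g, h1, rfl⟩
      exact ⟨g • e, Set.mem_biUnion ⟨g, h1, rfl⟩ (isGraphAction_aut.o_smul g e),
        isGraphAction_aut.t_smul g e⟩
  rintro (v | e)
  · refine ((hV v).image Sum.inl).subset ?_
    rintro _ ⟨g, h1, rfl⟩
    exact ⟨g • v, ⟨g, h1, rfl⟩, rfl⟩
  · refine (((hV (Γ.o e)).biUnion fun w _ => hfin w).image Sum.inr).subset ?_
    rintro _ ⟨g, h1, rfl⟩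
    exact ⟨g • e, Set.mem_biUnion ⟨g, h1, rfl⟩ (isGraphAction_aut.o_smul g e), rfl⟩

theorem isOpen_setOf_smul_eq (y z : V ⊕ E) : IsOpen {g : Γ.Aut | g • y = z} :=
  TopologicalSpace.isOpen_generateFrom_of_mem ⟨y, z, rfl⟩

theorem le_nhds_iff_smul {F : Filter Γ.Aut} {g : Γ.Aut} :
    F ≤ nhds g ↔ ∀ y : V ⊕ E, {h : Γ.Aut | h • y = g • y} ∈ F := by
  refine ⟨fun h y => h ((isOpen_setOf_smul_eq y (g • y)).mem_nhds rfl), fun h => ?_⟩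
  rw [TopologicalSpace.nhds_generateFrom]
  refine le_iInf₂ fun s hs => ?_
  obtain ⟨hgs, y, z, rfl⟩ := hs
  have hgz : g • y = z := hgs
  rw [Filter.le_principal_iff, ← hgz]
  exact h y

/-- Orbits under the stabilizer are finite, so along an ultrafilter the image of each point is
eventually constant. The pointwise limit is the limit automorphism. -/
theorem isCompact_stabilizer_vertex (hfin : Γ.IsLocallyFinite) (hconn : Γ.IsConnected) (x : V) :
    IsCompact {g : Γ.Aut | g • x = x} := by
  rw [isCompact_iff_ultrafilter_le_nhds]
  intro F hF
  rw [Filter.le_principal_iff] at hF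
  have hx : {g : Γ.Aut | g • x = x} ∈ F := hF
  -- Limits of the inverses are taken as well, to provide an inverse of the limit map.
  have hxi : {g : Γ.Aut | g⁻¹ • x = x} ∈ F := by
    refine Filter.mem_of_superset hx fun g hg => ?_
    change g⁻¹ • x = x
    rw [inv_smul_eq_iff]
    exact hg.symm
  have hlim : ∀ y : V ⊕ E, ∃ z, {g : Γ.Aut | g • y = z} ∈ F := by
    intro y
    obtain ⟨z, -, hz⟩ := (Ultrafilter.finite_biUnion_mem_iff
      (finite_orbit_stabilizer hfin hconn x y)
      (s := fun z => {g : Γ.Aut | g • y = z})).1 (Filter.mem_of_superset hx fun g hg =>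
        Set.mem_biUnion ⟨g, hg, rfl⟩ rfl)
    exact ⟨z, hz⟩
  have hlim' : ∀ y : V ⊕ E, ∃ z, {g : Γ.Aut | g⁻¹ • y = z} ∈ F := by
    intro y
    obtain ⟨z, -, hz⟩ := (Ultrafilter.finite_biUnion_mem_iff
      (finite_orbit_stabilizer hfin hconn x y)
      (s := fun z => {g : Γ.Aut | g⁻¹ • y = z})).1 (Filter.mem_of_superset hxi fun g hg =>
        Set.mem_biUnion ⟨g⁻¹, hg, rfl⟩ rfl)
    exact ⟨z, hz⟩
  have hVl : ∀ v : V, ∃ w : V, {g : Γ.Aut | g • v = w} ∈ F := fun v => by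
    obtain ⟨z, hz⟩ := hlim (Sum.inl v)
    obtain ⟨g, hg⟩ := F.nonempty_of_mem hz
    obtain rfl : g • (Sum.inl v : V ⊕ E) = z := hg
    exact ⟨g • v, Filter.mem_of_superset hz fun h hh => Sum.inl_injective hh⟩
  have hEl : ∀ v : E, ∃ w : E, {g : Γ.Aut | g • v = w} ∈ F := fun v => by
    obtain ⟨z, hz⟩ := hlim (Sum.inr v)
    obtain ⟨g, hg⟩ := F.nonempty_of_mem hz
    obtain rfl : g • (Sum.inr v : V ⊕ E) = z := hg
    exact ⟨g • v, Filter.mem_of_superset hz fun h hh => Sum.inr_injective hh⟩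
  have hVl' : ∀ v : V, ∃ w : V, {g : Γ.Aut | g⁻¹ • v = w} ∈ F := fun v => by
    obtain ⟨z, hz⟩ := hlim' (Sum.inl v)
    obtain ⟨g, hg⟩ := F.nonempty_of_mem hz
    obtain rfl : g⁻¹ • (Sum.inl v : V ⊕ E) = z := hg
    exact ⟨g⁻¹ • v, Filter.mem_of_superset hz fun h hh => Sum.inl_injective hh⟩
  have hEl' : ∀ v : E, ∃ w : E, {g : Γ.Aut | g⁻¹ • v = w} ∈ F := fun v => by
    obtain ⟨z, hz⟩ := hlim' (Sum.inr v)
    obtain ⟨g, hg⟩ := F.nonempty_of_mem hz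
    obtain rfl : g⁻¹ • (Sum.inr v : V ⊕ E) = z := hg
    exact ⟨g⁻¹ • v, Filter.mem_of_superset hz fun h hh => Sum.inr_injective hh⟩
  choose p hp using hVl
  choose p' hp' using hVl'
  choose q hq using hEl
  choose q' hq' using hEl'
  let a : Equiv.Perm V :=
    { toFun := p
      invFun := p'
      left_inv := fun v => by
        obtain ⟨g, h1, h2⟩ := F.nonempty_of_mem (Filter.inter_mem (hp v) (hp' (p v)))
        have h1 : g • v = p v := h1
        have h2 : g⁻¹ • p v = p' (p v) := h2
        rw [← h2, ← h1, inv_smul_smul]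
      right_inv := fun v => by
        obtain ⟨g, h1, h2⟩ := F.nonempty_of_mem (Filter.inter_mem (hp' v) (hp (p' v)))
        have h1 : g⁻¹ • v = p' v := h1
        have h2 : g • p' v = p (p' v) := h2
        rw [← h2, ← h1, smul_inv_smul] }
  let b : Equiv.Perm E :=
    { toFun := q
      invFun := q'
      left_inv := fun v => by
        obtain ⟨g, h1, h2⟩ := F.nonempty_of_mem (Filter.inter_mem (hq v) (hq' (q v)))
        have h1 : g • v = q v := h1
        have h2 : g⁻¹ • q v = q' (q v) := h2
        rw [← h2, ← h1, inv_smul_smul]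
      right_inv := fun v => by
        obtain ⟨g, h1, h2⟩ := F.nonempty_of_mem (Filter.inter_mem (hq' v) (hq (q' v)))
        have h1 : g⁻¹ • v = q' v := h1
        have h2 : g • q' v = q (q' v) := h2
        rw [← h2, ← h1, smul_inv_smul] }
  have hab : (a, b) ∈ Γ.autSubgroup := by
    refine ⟨fun e => ?_, fun e => ?_, fun e => ?_⟩
    · obtain ⟨g, h1, h2⟩ := F.nonempty_of_mem (Filter.inter_mem (hp (Γ.o e)) (hq e))
      have h1 : g • Γ.o e = p (Γ.o e) := h1
      have h2 : g • e = q e := h2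
      change p (Γ.o e) = Γ.o (q e)
      rw [← h1, ← h2, isGraphAction_aut.o_smul]
    · obtain ⟨g, h1, h2⟩ := F.nonempty_of_mem (Filter.inter_mem (hp (Γ.t e)) (hq e))
      have h1 : g • Γ.t e = p (Γ.t e) := h1
      have h2 : g • e = q e := h2
      change p (Γ.t e) = Γ.t (q e)
      rw [← h1, ← h2, isGraphAction_aut.t_smul]
    · obtain ⟨g, h1, h2⟩ := F.nonempty_of_mem (Filter.inter_mem (hq (Γ.bar e)) (hq e))
      have h1 : g • Γ.bar e = q (Γ.bar e) := h1
      have h2 : g • e = q e := h2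
      change q (Γ.bar e) = Γ.bar (q e)
      rw [← h1, ← h2, isGraphAction_aut.bar_smul]
  refine ⟨⟨(a, b), hab⟩, ?_, le_nhds_iff_smul.2 ?_⟩
  · obtain ⟨g, h1, h2⟩ := F.nonempty_of_mem (Filter.inter_mem (hp x) hx)
    have h1 : g • x = p x := h1
    have h2 : g • x = x := h2
    change p x = x
    rw [← h1, h2]
  · rintro (v | e)
    · exact Filter.mem_of_superset (hp v) fun g hg => congrArg Sum.inl hg
    · exact Filter.mem_of_superset (hq e) fun g hg => congrArg Sum.inr hg

theorem isProfiniteAction_aut (hfin : Γ.IsLocallyFinite) (hconn : Γ.IsConnected) :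
    IsProfiniteAction Γ.Aut (V ⊕ E) where
  isOpen_stabilizer x := isOpen_setOf_smul_eq x x
  isCompact_stabilizer := by
    rintro (v | e)
    · convert isCompact_stabilizer_vertex hfin hconn v using 1
      ext g
      exact Sum.inl_injective.eq_iff
    · refine (isCompact_stabilizer_vertex hfin hconn (Γ.o e)).of_isClosed_subset
        (Subgroup.isClosed_of_isOpen _ (isOpen_setOf_smul_eq (Sum.inr e) (Sum.inr e))) ?_
      intro g hg
      have hg : g • e = e := Sum.inr_injective hg
      change g • Γ.o e = Γ.o e
      rw [← isGraphAction_aut.o_smul, hg]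
  nhds_one U hU := by
    obtain ⟨s, hs, hsU⟩ := (TopologicalSpace.isTopologicalBasis_of_subbasis
      (α := Γ.Aut) rfl).mem_nhds_iff.1 hU
    obtain ⟨⟨f, ⟨hf, hfs⟩, rfl⟩, h1, hsub⟩ := show _ ∧ _ from ⟨hs, hsU⟩
    have hfs' : ∀ S : f, ∃ x y : V ⊕ E, (S : Set Γ.Aut) = {g : Γ.Aut | g • x = y} :=
      fun S => hfs S.2
    choose y z hyz using hfs'
    have := hf.to_subtype
    refine ⟨Set.range y, Set.finite_range _, fun g hg => hsub ?_⟩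
    intro S hS
    have h1S : (1 : Γ.Aut) ∈ S := h1 S hS
    rw [show S = _ from hyz ⟨S, hS⟩] at h1S ⊢
    have h1S : (1 : Γ.Aut) • y ⟨S, hS⟩ = z ⟨S, hS⟩ := h1S
    change g • y ⟨S, hS⟩ = z ⟨S, hS⟩
    rw [hg _ ⟨_, rfl⟩, ← h1S, one_smul]
  faithful g hg := by
    refine Subtype.ext (Prod.ext (Equiv.ext fun v => ?_) (Equiv.ext fun e => ?_))
    · exact Sum.inl_injective (hg (Sum.inl v))
    · exact Sum.inr_injective (hg (Sum.inr e))

end SerreGraph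

theorem IsProfiniteAction.subgroup {A : Type u} {X : Type v} [Group A] [TopologicalSpace A]
    [MulAction A X] (hA : IsProfiniteAction A X) {H : Subgroup A} (hH : IsClosed (H : Set A)) :
    IsProfiniteAction H X where
  isOpen_stabilizer x := (hA.isOpen_stabilizer x).preimage continuous_subtype_val
  isCompact_stabilizer x :=
    hH.isClosedEmbedding_subtypeVal.isCompact_preimage (hA.isCompact_stabilizer x)
  nhds_one U hU := by
    obtain ⟨W, hW, hWU⟩ := mem_nhds_induced _ _ _ |>.1 hU
    obtain ⟨F, hF, h⟩ := hA.nhds_one W hW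
    exact ⟨F, hF, fun g hg => hWU (h g hg)⟩
  faithful g hg := Subtype.ext (hA.faithful g hg)

/-! ### Local actions of normal subgroups and of intermediate subgroups. -/

namespace SerreGraph

variable {V : Type u} {E : Type v} {Γ : SerreGraph V E}

/-- The permutation of the star of a vertex induced by an automorphism fixing this vertex. -/
def starPerm (z : V) (a : Γ.Aut) (ha : a • z = z) : Equiv.Perm (Γ.star z) where
  toFun e := ⟨a • (e : E), (isGraphAction_aut.o_smul a e).trans
    ((congrArg (a • ·) e.2).trans ha)⟩
  invFun e := ⟨a⁻¹ • (e : E), (isGraphAction_aut.o_smul a⁻¹ e).trans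
    ((congrArg (a⁻¹ • ·) e.2).trans (inv_smul_eq_iff.2 ha.symm))⟩
  left_inv e := Subtype.ext (inv_smul_smul a (e : E))
  right_inv e := Subtype.ext (smul_inv_smul a (e : E))

theorem starPerm_mem {H : Subgroup Γ.Aut} {z : V} {a : Γ.Aut} (ha : a • z = z) (haH : a ∈ H) :
    starPerm z a ha ∈ localAction H z :=
  ⟨a, haH, ha, fun _ => rfl⟩

/-- The subgroup of the local action at `z` induced by a subgroup of `H`. -/
def localSubgroup {H : Subgroup Γ.Aut} (N : Subgroup H) (z : V) :
    Subgroup (localAction H z) :=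
  (localAction (N.map H.subtype) z).subgroupOf (localAction H z)

theorem mem_localSubgroup {H : Subgroup Γ.Aut} {N : Subgroup H} {z : V} {σ : localAction H z} :
    σ ∈ localSubgroup N z ↔
      ∃ n ∈ N, n • z = z ∧ ∀ e : Γ.star z, ((σ : Equiv.Perm (Γ.star z)) e : E) = n • (e : E) := by
  constructor
  · rintro ⟨_, ⟨n, hn, rfl⟩, h1, h2⟩
    exact ⟨n, hn, h1, h2⟩
  · rintro ⟨n, hn, h1, h2⟩
    exact ⟨n, ⟨n, hn, rfl⟩, h1, h2⟩

theorem smul_eq_of_smul_edge {A : Type w} [Group A] [MulAction A V] [MulAction A E]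
    (hA : Γ.IsGraphAction A) {a : A} {e f : E} {z : V} (he : Γ.o e = z) (hf : Γ.o f = z)
    (h : a • e = f) : a • z = z := by
  rw [← he, ← hA.o_smul, h, hf, he]

theorem isStarTransitive_of_isPretransitive {H : Subgroup Γ.Aut} {N : Subgroup H} {z : V}
    (h : MulAction.IsPretransitive (localSubgroup N z) (Γ.star z)) : Γ.IsStarTransitive N z := by
  intro e f he hf
  obtain ⟨⟨σ, hσ⟩, h1⟩ := h.exists_smul_eq ⟨e, he⟩ ⟨f, hf⟩
  obtain ⟨n, hn, -, h2⟩ := mem_localSubgroup.1 hσ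
  exact ⟨n, hn, (h2 ⟨e, he⟩).symm.trans (congrArg Subtype.val h1)⟩

theorem isStarTransitive_top {H : Subgroup Γ.Aut} {z : V}
    (h : MulAction.IsPretransitive (localAction H z) (Γ.star z)) :
    Γ.IsStarTransitive (⊤ : Subgroup H) z := by
  intro e f he hf
  obtain ⟨⟨σ, a, ha, _, h2⟩, h1⟩ := h.exists_smul_eq ⟨e, he⟩ ⟨f, hf⟩
  exact ⟨⟨a, ha⟩, trivial, (h2 ⟨e, he⟩).symm.trans (congrArg Subtype.val h1)⟩

theorem isStarSemiregular_of_stabilizer_eq_bot {H : Subgroup Γ.Aut} {N : Subgroup H} {z : V}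
    (h : ∀ ω : Γ.star z, MulAction.stabilizer (localSubgroup N z) ω = ⊥) :
    Γ.IsStarSemiregular N z := by
  intro n hn e f he hf hne
  have hz : n • z = z := smul_eq_of_smul_edge (isGraphAction_aut.subgroup H) he he hne
  let σ : localSubgroup N z := ⟨⟨starPerm z n hz, starPerm_mem hz n.2⟩,
    mem_localSubgroup.2 ⟨n, hn, hz, fun _ => rfl⟩⟩
  have hσ : σ ∈ MulAction.stabilizer (localSubgroup N z) (⟨e, he⟩ : Γ.star z) :=
    Subtype.ext hne
  rw [h, Subgroup.mem_bot] at hσ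
  have : σ • (⟨f, hf⟩ : Γ.star z) = ⟨f, hf⟩ := by rw [hσ, one_smul]
  exact congrArg Subtype.val this

theorem normal_localSubgroup {H : Subgroup Γ.Aut} {N : Subgroup H} (hN : N.Normal) (z : V) :
    (localSubgroup N z).Normal where
  conj_mem σ hσ τ := by
    obtain ⟨n, hn, hnz, h⟩ := mem_localSubgroup.1 hσ
    obtain ⟨a, ha, haz, hτ⟩ := τ.2
    obtain ⟨b, rfl⟩ : ∃ b : H, (b : Γ.Aut) = a := ⟨⟨a, ha⟩, rfl⟩
    have haz : b • z = z := haz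
    have hτ : ∀ e : Γ.star z, ((τ : Equiv.Perm (Γ.star z)) e : E) = b • (e : E) := hτ
    refine mem_localSubgroup.2 ⟨b * n * b⁻¹, hN.conj_mem n hn _, ?_, fun e => ?_⟩
    · rw [mul_smul, mul_smul, inv_smul_eq_iff.2 haz.symm, hnz, haz]
    · obtain ⟨f, rfl⟩ := (τ : Equiv.Perm (Γ.star z)).surjective e
      have h1 : ((τ * σ * τ⁻¹ : localAction H z) : Equiv.Perm (Γ.star z))
          ((τ : Equiv.Perm (Γ.star z)) f) =
          (τ : Equiv.Perm (Γ.star z)) ((σ : Equiv.Perm (Γ.star z)) f) := by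
        simp
      rw [h1, hτ, h, hτ, mul_smul, mul_smul, inv_smul_smul]

theorem IsLocallySemiprimitive.isStarTransitive_or {H : Subgroup Γ.Aut}
    (h : IsLocallySemiprimitive H) (N : Subgroup H) (hN : N.Normal) (z : V) :
    Γ.IsStarTransitive N z ∨ Γ.IsStarSemiregular N z :=
  ((h z).2 _ (normal_localSubgroup hN z)).imp isStarTransitive_of_isPretransitive
    isStarSemiregular_of_stabilizer_eq_bot

/-- Edge stabilizers are maximal among the subgroups of the vertex stabilizers that are not
transitive on the star. -/
theorem IsLocallyPrimitive.le_stabilizer_or {H : Subgroup Γ.Aut} (h : IsLocallyPrimitive H)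
    (e : E) (N : Subgroup H) (h1 : MulAction.stabilizer H e ≤ N)
    (h2 : N ≤ MulAction.stabilizer H (Γ.o e)) :
    N ≤ MulAction.stabilizer H e ∨ ∀ f, Γ.o f = Γ.o e → ∃ n ∈ N, n • e = f := by
  have hle : MulAction.stabilizer (localAction H (Γ.o e)) (⟨e, rfl⟩ : Γ.star (Γ.o e)) ≤
      localSubgroup N (Γ.o e) := by
    intro σ hσ
    obtain ⟨a, ha, haz, h3⟩ := σ.2
    have hae : a • e = e := (h3 ⟨e, rfl⟩).symm.trans (congrArg Subtype.val hσ)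
    exact mem_localSubgroup.2 ⟨⟨a, ha⟩, h1 (MulAction.mem_stabilizer_iff.2 hae), haz, h3⟩
  -- The orbit of `e` under a group containing its point stabilizer is a block; primitivity makes it
  -- a point or the whole star.
  have hb := (h (Γ.o e)).isTrivialBlock_of_isBlock (MulAction.IsBlock.of_orbit hle)
  rcases hb with hb | hb
  · left
    intro n hn
    have hz : n • Γ.o e = Γ.o e := h2 hn
    let σ : localSubgroup N (Γ.o e) := ⟨⟨starPerm _ n hz, starPerm_mem hz n.2⟩,
      mem_localSubgroup.2 ⟨n, hn, hz, fun _ => rfl⟩⟩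
    have := hb (MulAction.mem_orbit (⟨e, rfl⟩ : Γ.star (Γ.o e)) σ)
      (MulAction.mem_orbit_self (⟨e, rfl⟩ : Γ.star (Γ.o e)))
    exact congrArg Subtype.val this
  · right
    intro f hf
    have : (⟨f, hf⟩ : Γ.star (Γ.o e)) ∈
        MulAction.orbit (localSubgroup N (Γ.o e)) (⟨e, rfl⟩ : Γ.star (Γ.o e)) := by
      rw [hb]; trivial
    obtain ⟨⟨σ, hσ⟩, h3⟩ := this
    obtain ⟨n, hn, -, h4⟩ := mem_localSubgroup.1 hσ
    exact ⟨n, hn, (h4 ⟨e, rfl⟩).symm.trans (congrArg Subtype.val h3)⟩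

end SerreGraph

/-! ### Reduced words and amalgams acting on trees. -/

namespace SerreGraph

variable {V : Type u} {E : Type v} {Γ : SerreGraph V E}

/-- There is a non-backtracking path from the vertex `y` whose last edge is `f`. -/
def HasReducedPath (Γ : SerreGraph V E) (y : V) (f : E) : Prop :=
  ∃ (p : List E) (hp : p ≠ []), Γ.IsNonBacktrackingPath p ∧ Γ.o (p.head hp) = y ∧ p.getLast hp = f

theorem HasReducedPath.single {y : V} {f : E} (h : Γ.o f = y) : Γ.HasReducedPath y f :=
  ⟨[f], by simp, by simp [IsNonBacktrackingPath], h, rfl⟩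

theorem HasReducedPath.snoc {y : V} {f f' : E} (h : Γ.HasReducedPath y f) (h1 : Γ.t f = Γ.o f')
    (h2 : f' ≠ Γ.bar f) : Γ.HasReducedPath y f' := by
  obtain ⟨p, hp, hnb, ho, hl⟩ := h
  refine ⟨p ++ [f'], by simp, ?_, by rwa [List.head_append_of_ne_nil hp], by simp⟩
  refine List.isChain_append.2 ⟨hnb, by simp, fun a ha b hb => ?_⟩
  rw [List.getLast?_eq_some_getLast hp, hl] at ha
  obtain rfl : f = a := by simpa using ha
  obtain rfl : f' = b := by simpa using hb
  exact ⟨h1, h2⟩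

theorem HasReducedPath.terminus_ne (hforest : Γ.IsForest) {y : V} {f : E}
    (h : Γ.HasReducedPath y f) : Γ.t f ≠ y := by
  obtain ⟨p, hp, hnb, ho, hl⟩ := h
  have := hforest p hp hnb
  rw [ho, hl] at this
  exact this.symm

variable {A : Type w} [Group A] [MulAction A V] [MulAction A E]

/-- `IsReducedWord e B C g i` holds if `g` is a product `c₀ b₁ c₁ ⋯ bₙ cₙ` in which no cancellation
is possible, ready to be followed by an element of `B i`. -/
inductive IsReducedWord {I : Type*} (e : I → E) (B : I → Subgroup A) (C : Subgroup A) :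
    A → I → Prop
  | base {c : A} {j : I} : c ∈ C → IsReducedWord e B C c j
  | step {g b c : A} {i j : I} : IsReducedWord e B C g i → b ∈ B i → b • e i ≠ e i → c ∈ C →
      c • e j ≠ e i → IsReducedWord e B C (g * b * c) j

section Amalgam

variable {I : Type*} {e : I → E} {B : I → Subgroup A} {C : Subgroup A} {y : V}

/-- Since `b` fixes the terminus of `e i` but moves `e i` itself, the path can leave that terminus
along a different edge. -/
theorem IsReducedWord.step_path (hA : Γ.IsGraphAction A)
    (hBt : ∀ i, ∀ b ∈ B i, b • Γ.t (e i) = Γ.t (e i)) {g b : A} {i : I} (hb : b ∈ B i)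
    (hne : b • e i ≠ e i) (h : Γ.HasReducedPath y (g • e i)) :
    Γ.HasReducedPath y (Γ.bar ((g * b) • e i)) := by
  refine h.snoc ?_ fun heq => hne ?_
  · rw [Γ.o_bar, hA.t_smul, hA.t_smul, mul_smul, hBt i b hb]
  · have := congrArg Γ.bar heq
    rwa [Γ.bar_bar, Γ.bar_bar, mul_smul, smul_left_cancel_iff] at this

/-- Each syllable `b c` prolongs the path by two edges, and the two conditions in
`IsReducedWord.step` are exactly the absence of backtracking at each of them. -/
theorem IsReducedWord.hasReducedPath (hA : Γ.IsGraphAction A) (he : ∀ i, Γ.o (e i) = y)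
    (hC : ∀ c ∈ C, c • y = y) (hBt : ∀ i, ∀ b ∈ B i, b • Γ.t (e i) = Γ.t (e i))
    {g : A} {j : I} (h : IsReducedWord e B C g j) : Γ.HasReducedPath y (g • e j) := by
  induction h with
  | base hc => exact .single (by rw [hA.o_smul, he, hC _ hc])
  | @step g b c i j _ hb hne hc hce ih =>
    refine (step_path hA hBt hb hne ih).snoc ?_ fun heq => hce ?_
    · rw [Γ.t_bar, hA.o_smul, hA.o_smul, he, he, mul_smul (g * b), hC c hc]
    · rwa [Γ.bar_bar, mul_smul (g * b), smul_left_cancel_iff] at heq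

/-- The factor `c` is absorbed into the last letter from `C`. If this spoils reducedness, `hinj` and
`hCB` put that letter in `B k`, and the correction `b` erases the whole last syllable. -/
theorem IsReducedWord.exists_mul (hCB : ∀ i, ∀ c ∈ C, c • e i = e i → c ∈ B i)
    (hinj : ∀ i j, ∀ c ∈ C, c • e j = e i → i = j) {g c : A} {j : I}
    (h : IsReducedWord e B C g j) (hc : c ∈ C) (k : I) :
    ∃ b ∈ B k, IsReducedWord e B C (g * c * b) k := by
  cases h with
  | base hg => exact ⟨1, one_mem _, .base (mul_mem (mul_mem hg hc) (one_mem _))⟩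
  | @step g b' c' i _ hg hb hne hc' hce =>
    by_cases hk : (c' * c) • e k = e i
    · obtain rfl := hinj _ _ _ (mul_mem hc' hc) hk
      refine ⟨(b' * (c' * c))⁻¹, inv_mem (mul_mem hb (hCB _ _ (mul_mem hc' hc) hk)), ?_⟩
      have : g * b' * c' * c * (b' * (c' * c))⁻¹ = g := by group
      rwa [this]
    · refine ⟨1, one_mem _, ?_⟩
      have := IsReducedWord.step hg hb hne (mul_mem hc' hc) hk
      simpa [mul_assoc] using this

/-- In a tree, a group generated by stabilizers glued along edges has no new vertex stabilizer. -/
theorem IsForest.mem_of_mem_sup (hforest : Γ.IsForest) (hA : Γ.IsGraphAction A) [Nonempty I]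
    (he : ∀ i, Γ.o (e i) = y)
    (hC : ∀ c ∈ C, c • y = y) (hBt : ∀ i, ∀ b ∈ B i, b • Γ.t (e i) = Γ.t (e i))
    (hBC : ∀ i, ∀ b ∈ B i, b • e i = e i → b ∈ C)
    (hCB : ∀ i, ∀ c ∈ C, c • e i = e i → c ∈ B i)
    (hinj : ∀ i j, ∀ c ∈ C, c • e j = e i → i = j) {g : A} (hg : g ∈ C ⊔ ⨆ i, B i)
    (hgy : g • y = y) : g ∈ C := by
  have hB : ∀ g b : A, ∀ i, b ∈ B i → (∀ k, ∃ b ∈ B k, IsReducedWord e B C (g * b) k) →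
      ∀ k, ∃ b' ∈ B k, IsReducedWord e B C (g * b * b') k := by
    intro g b i hb hgood k
    obtain ⟨b₁, hb₁, hw⟩ := hgood i
    have hb₂ := mul_mem (inv_mem hb₁) hb
    by_cases h1 : (b₁⁻¹ * b) • e i = e i
    · have := hw.exists_mul hCB hinj (hBC i _ hb₂ h1) k
      simpa using this
    · by_cases h2 : e k = e i
      · obtain rfl := hinj i k 1 (one_mem _) (by rwa [one_smul])
        exact ⟨b⁻¹ * b₁, mul_mem (inv_mem hb) hb₁, by simpa [mul_assoc] using hw⟩
      · refine ⟨1, one_mem _, ?_⟩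
        have := IsReducedWord.step hw hb₂ h1 (one_mem C) (j := k) (by rwa [one_smul])
        simpa [mul_assoc] using this
  have hCg : ∀ g c : A, c ∈ C → (∀ k, ∃ b ∈ B k, IsReducedWord e B C (g * b) k) →
      ∀ k, ∃ b' ∈ B k, IsReducedWord e B C (g * c * b') k := by
    intro g c hc hgood k
    obtain ⟨i⟩ := ‹Nonempty I›
    obtain ⟨b₁, hb₁, hw⟩ := hgood i
    by_cases h1 : b₁⁻¹ • e i = e i
    · have := hw.exists_mul hCB hinj (mul_mem (hBC i _ (inv_mem hb₁) h1) hc) k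
      simpa [mul_assoc] using this
    · by_cases h2 : c • e k = e i
      · obtain rfl := hinj _ _ _ hc h2
        exact ⟨c⁻¹ * b₁, mul_mem (inv_mem (hCB _ _ hc h2)) hb₁, by simpa [mul_assoc] using hw⟩
      · refine ⟨1, one_mem _, ?_⟩
        have := IsReducedWord.step hw (inv_mem hb₁) h1 hc h2
        simpa [mul_assoc] using this
  -- The elements `g` such that right multiplication by `g` and by `g⁻¹` preserves the property of
  -- being, for each `k`, a reduced word up to a right factor from `B k`.
  let Z : Subgroup A :=
    { carrier := {g | ∀ g₀ : A, (∀ k, ∃ b ∈ B k, IsReducedWord e B C (g₀ * b) k) →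
        (∀ k, ∃ b ∈ B k, IsReducedWord e B C (g₀ * g * b) k) ∧
        (∀ k, ∃ b ∈ B k, IsReducedWord e B C (g₀ * g⁻¹ * b) k)}
      one_mem' := fun g₀ h => by simpa using h
      mul_mem' := fun {g g'} hg hg' g₀ h => by
        refine ⟨?_, ?_⟩
        · simpa [mul_assoc] using (hg' _ (hg g₀ h).1).1
        · simpa [mul_assoc] using (hg _ (hg' g₀ h).2).2
      inv_mem' := fun {g} hg g₀ h => by simpa using (hg g₀ h).symm }
  have hle : C ⊔ ⨆ i, B i ≤ Z :=
    sup_le (fun c hc g₀ h => ⟨hCg g₀ c hc h, hCg g₀ _ (inv_mem hc) h⟩)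
      (iSup_le fun i b hb g₀ h => ⟨hB g₀ b i hb h, hB g₀ _ i (inv_mem hb) h⟩)
  have h1 := (hle hg 1 fun k => ⟨1, one_mem _, .base (by simp)⟩).1
  obtain ⟨i⟩ := ‹Nonempty I›
  obtain ⟨b, hb, hw⟩ := h1 i
  rw [one_mul] at hw
  -- Unless `g` reduces to an element of `C`, there is a non-backtracking path starting at `y` and
  -- ending at `g • y = y`, which a forest forbids.
  by_cases hbi : b⁻¹ • e i = e i
  · have hbC := inv_mem (hBC i _ (inv_mem hb) hbi)
    rw [inv_inv] at hbC
    generalize hgb : g * b = g' at hw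
    cases hw with
    | base hg' =>
      rw [← hgb] at hg'
      exact (mul_mem_cancel_right hbC).1 hg'
    | @step g₁ b₁ c₁ j _ hw₁ hb₁ hne hc₁ hce =>
      exfalso
      have hp := (IsReducedWord.step_path hA hBt hb₁ hne
        (hw₁.hasReducedPath hA he hC hBt)).terminus_ne hforest
      rw [Γ.t_bar, hA.o_smul, he] at hp
      apply hp
      have : (g₁ * b₁) = g * (b * c₁⁻¹) := by
        rw [← mul_assoc, hgb]; group
      rw [this, mul_smul, hC _ (mul_mem hbC (inv_mem hc₁)), hgy]
  · exfalso
    have hp := (IsReducedWord.step_path hA hBt (inv_mem hb) hbi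
      (hw.hasReducedPath hA he hC hBt)).terminus_ne hforest
    rw [Γ.t_bar, hA.o_smul, he, mul_inv_cancel_right] at hp
    exact hp hgy

end Amalgam

end SerreGraph

/-! ### Products of subgroups, compactness and closedness. -/

theorem Subgroup.exists_mul_of_mem_sup {A : Type*} [Group A] {K L : Subgroup A}
    (h : IsConjInvariant L K) {x : A} (hx : x ∈ K ⊔ L) : ∃ k ∈ K, ∃ l ∈ L, k * l = x := by
  let Z : Subgroup A :=
    { carrier := {x | ∃ k ∈ K, ∃ l ∈ L, k * l = x}
      one_mem' := ⟨1, one_mem _, 1, one_mem _, one_mul 1⟩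
      mul_mem' := by
        rintro _ _ ⟨k, hk, l, hl, rfl⟩ ⟨k', hk', l', hl', rfl⟩
        exact ⟨k * (l * k' * l⁻¹), mul_mem hk (h l hl k' hk'), l * l', mul_mem hl hl', by group⟩
      inv_mem' := by
        rintro _ ⟨k, hk, l, hl, rfl⟩
        exact ⟨l⁻¹ * k⁻¹ * l⁻¹⁻¹, h _ (inv_mem hl) _ (inv_mem hk), l⁻¹, inv_mem hl, by group⟩ }
  have hle : K ⊔ L ≤ Z := sup_le (fun k hk => ⟨k, hk, 1, one_mem _, mul_one k⟩)
    fun l hl => ⟨1, one_mem _, l, hl, one_mul l⟩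
  exact hle hx

theorem Subgroup.isCompact_sup {A : Type*} [Group A] [TopologicalSpace A] [ContinuousMul A]
    {K L : Subgroup A} (h : IsConjInvariant L K) (hK : IsCompact (K : Set A))
    (hL : IsCompact (L : Set A)) : IsCompact ((K ⊔ L : Subgroup A) : Set A) := by
  have : ((K ⊔ L : Subgroup A) : Set A) = (K : Set A) * (L : Set A) := by
    ext x
    rw [Set.mem_mul]
    refine ⟨fun hx => Subgroup.exists_mul_of_mem_sup h hx, ?_⟩
    rintro ⟨k, hk, l, hl, rfl⟩
    exact mul_mem (Subgroup.mem_sup_left hk) (Subgroup.mem_sup_right hl)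
  rw [this]
  exact hK.mul hL

/-- A subgroup meeting an open subgroup in a closed set is closed. -/
theorem Subgroup.isClosed_of_isClosed_inf {A : Type*} [Group A] [TopologicalSpace A]
    [IsTopologicalGroup A] {R U : Subgroup A} (hU : IsOpen (U : Set A))
    (h : IsClosed ((R ⊓ U : Subgroup A) : Set A)) : IsClosed (R : Set A) := by
  refine isClosed_of_closure_subset fun r hr => ?_
  have hro : IsOpen ((fun x => r⁻¹ * x) ⁻¹' (U : Set A)) := hU.preimage (by fun_prop)
  -- Translating by an element `s` of `R` close to `r` moves the limit point into `U`.
  obtain ⟨s, hsU, hsR⟩ := mem_closure_iff.1 hr _ hro (by simp [one_mem])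
  have hrs : s⁻¹ * r ∈ _root_.closure (R : Set A) :=
    show s⁻¹ * r ∈ R.topologicalClosure from
      mul_mem (R.le_topologicalClosure (inv_mem hsR)) hr
  have hrsU : s⁻¹ * r ∈ U := by
    have := inv_mem (show r⁻¹ * s ∈ U from hsU)
    simpa using this
  have : s⁻¹ * r ∈ _root_.closure ((R ⊓ U : Subgroup A) : Set A) := by
    rw [Subgroup.coe_inf, Set.inter_comm]
    exact hU.inter_closure ⟨hrsU, hrs⟩
  rw [h.closure_eq] at this
  have := mul_mem hsR this.1
  simpa using this

/-! ### The compact parts generated by the minimal subgroups. -/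

section MinimalPart

variable {A : Type u} {X : Type v} [Group A] [TopologicalSpace A] [IsTopologicalGroup A]
  [MulAction A X]

/-- The subgroup generated by the elements of `U` lying in some minimal admissible subgroup. -/
def minimalPart (U : Subgroup A) : Subgroup A :=
  ⨆ M ∈ {M | Minimal (IsAdmissible A) M}, M ⊓ U

theorem inf_le_minimalPart {U M : Subgroup A} (hM : Minimal (IsAdmissible A) M) :
    M ⊓ U ≤ minimalPart U :=
  le_iSup₂_of_le (f := fun M (_ : M ∈ {M | Minimal (IsAdmissible A) M}) => M ⊓ U) M hM le_rfl

theorem minimalPart_le (U : Subgroup A) : minimalPart U ≤ U := iSup₂_le fun _ _ => inf_le_right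

theorem minimalPart_le_sSup (U : Subgroup A) :
    minimalPart U ≤ sSup {M | Minimal (IsAdmissible A) M} :=
  iSup₂_le fun _ hM => inf_le_left.trans (le_sSup hM)

theorem minimalPart_mono {U U' : Subgroup A} (h : U ≤ U') : minimalPart U ≤ minimalPart U' :=
  iSup₂_mono fun _ _ => inf_le_inf_left _ h

namespace IsBurgerMozesAction

theorem conj_mem_minimalPart (hA : IsBurgerMozesAction A X) {U U' : Subgroup A} {a : A}
    (h : ∀ u ∈ U, a * u * a⁻¹ ∈ U') {n : A} (hn : n ∈ minimalPart U) :
    a * n * a⁻¹ ∈ minimalPart U' := by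
  have : minimalPart U ≤ (minimalPart U').comap (MulAut.conj a).toMonoidHom := by
    refine iSup₂_le fun M hM m hm => ?_
    refine inf_le_minimalPart (hA.minimal_conj_smul hM a) ⟨mem_conj_iff.2 ?_, h m hm.2⟩
    simpa [mul_assoc] using hm.1
  exact this hn

theorem isConjInvariant_minimalPart (hA : IsBurgerMozesAction A X) {U L : Subgroup A}
    (h : IsConjInvariant L U) : IsConjInvariant L (minimalPart U) := fun l hl _ hn =>
  hA.conj_mem_minimalPart (h l hl) hn

/-- There are finitely many minimal subgroups and their intersections with `U` normalize one
another, so the join is a finite product of compact sets. -/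
theorem isCompact_minimalPart (hA : IsBurgerMozesAction A X) {U : Subgroup A}
    (hU : IsCompact (U : Set A)) : IsCompact (minimalPart U : Set A) := by
  classical
  have key : ∀ s : Finset (Subgroup A), (∀ M ∈ s, Minimal (IsAdmissible A) M) →
      IsCompact ((⨆ M ∈ s, M ⊓ U : Subgroup A) : Set A) := by
    intro s
    induction s using Finset.induction_on with
    | empty => simp
    | insert M s _ ih =>
      intro hs
      rw [Finset.iSup_insert]
      have hM := hs M (Finset.mem_insert_self _ _)
      have hs' : ∀ M ∈ s, Minimal (IsAdmissible A) M := fun M h =>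
        hs M (Finset.mem_insert_of_mem h)
      refine Subgroup.isCompact_sup (fun l hl k hk => ?_)
        (hU.inter_left hM.1.isClosed) (ih hs')
      have h1 : l ∈ cocompactResidual A := (iSup₂_le fun M hM =>
        inf_le_left.trans (hs' M hM).1.le_residual : (⨆ M ∈ s, M ⊓ U) ≤ cocompactResidual A) hl
      have h2 : l ∈ U := (iSup₂_le fun M hM => inf_le_right : (⨆ M ∈ s, M ⊓ U) ≤ U) hl
      exact ⟨hM.1.conj l h1 k hk.1, U.mul_mem (U.mul_mem h2 hk.2) (U.inv_mem h2)⟩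
  have := key hA.finite_minimal.toFinset (by simp)
  simpa [minimalPart] using this

end IsBurgerMozesAction

end MinimalPart

/-! ### Locally primitive actions on trees: the minimal subgroups generate the residual. -/

namespace SerreGraph

variable {V : Type u} {E : Type v} {Γ : SerreGraph V E}
  {A : Type w} [Group A] [MulAction A V] [MulAction A E]

variable (Γ A) in
/-- Edge stabilizers are maximal among the subgroups of the vertex stabilizers that are not
transitive on the star. -/
def HasMaximalEdgeStabilizers : Prop :=
  ∀ (e : E) (N : Subgroup A), MulAction.stabilizer A e ≤ N →
    N ≤ MulAction.stabilizer A (Γ.o e) →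
    N ≤ MulAction.stabilizer A e ∨ ∀ f, Γ.o f = Γ.o e → ∃ n ∈ N, n • e = f

theorem IsGraphAction.stabilizer_le_o (hA : Γ.IsGraphAction A) (e : E) :
    MulAction.stabilizer A e ≤ MulAction.stabilizer A (Γ.o e) := fun a ha => by
  rw [MulAction.mem_stabilizer_iff] at ha ⊢
  rw [← hA.o_smul, ha]

theorem IsGraphAction.stabilizer_le_t (hA : Γ.IsGraphAction A) (e : E) :
    MulAction.stabilizer A e ≤ MulAction.stabilizer A (Γ.t e) := fun a ha => by
  rw [MulAction.mem_stabilizer_iff] at ha ⊢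
  rw [← hA.t_smul, ha]

/-- Maximality is applied to `K` times the stabilizer of `e`. If this fixes `e`, then `K` does, and
by conjugation it fixes the star; if it is transitive, so is `K`, because the other factor fixes
`e`. -/
theorem HasMaximalEdgeStabilizers.isStarTransitive_or (hprim : HasMaximalEdgeStabilizers Γ A)
    (hA : Γ.IsGraphAction A) (htrans : ∀ z, Γ.IsStarTransitive (⊤ : Subgroup A) z) {z : V}
    {K : Subgroup A} (hK : K ≤ MulAction.stabilizer A z)
    (hinv : IsConjInvariant (MulAction.stabilizer A z) K) :
    Γ.IsStarTransitive K z ∨ ∀ k ∈ K, ∀ f, Γ.o f = z → k • f = f := by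
  by_cases hz : ∃ e, Γ.o e = z
  swap
  · exact Or.inl fun e _ he => absurd ⟨e, he⟩ hz
  obtain ⟨e, rfl⟩ := hz
  rcases hprim e (K ⊔ MulAction.stabilizer A e) le_sup_right
    (sup_le hK (hA.stabilizer_le_o e)) with h | h
  · right
    intro k hk f hf
    obtain ⟨b, -, rfl⟩ := htrans _ e f rfl hf
    have hb : b⁻¹ ∈ MulAction.stabilizer A (Γ.o e) :=
      inv_mem (smul_eq_of_smul_edge hA rfl hf rfl)
    have := h (Subgroup.mem_sup_left (hinv _ hb k hk))
    rw [MulAction.mem_stabilizer_iff, inv_inv, mul_smul, mul_smul, inv_smul_eq_iff] at this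
    exact this
  · left
    have hK' : ∀ f, Γ.o f = Γ.o e → ∃ k ∈ K, k • e = f := by
      intro f hf
      obtain ⟨n, hn, rfl⟩ := h f hf
      obtain ⟨k, hk, s, hs, rfl⟩ := Subgroup.exists_mul_of_mem_sup
        (fun l hl => hinv l (hA.stabilizer_le_o e hl)) hn
      exact ⟨k, hk, by rw [mul_smul, MulAction.mem_stabilizer_iff.1 hs]⟩
    intro f f' hf hf'
    obtain ⟨k, hk, rfl⟩ := hK' f hf
    obtain ⟨k', hk', rfl⟩ := hK' f' hf'
    exact ⟨k' * k⁻¹, mul_mem hk' (inv_mem hk), by rw [mul_smul, inv_smul_smul]⟩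

theorem isConjInvariant_stabilizer {Y : Type*} [MulAction A Y] (y : Y) :
    IsConjInvariant (MulAction.stabilizer A y) (MulAction.stabilizer A y) := fun _ hg _ hn =>
  mul_mem (mul_mem hg hn) (inv_mem hg)

theorem conj_mem_stabilizer {Y : Type*} [MulAction A Y] (a : A) (y : Y) :
    ∀ u ∈ MulAction.stabilizer A y, a * u * a⁻¹ ∈ MulAction.stabilizer A (a • y) := by
  intro u hu
  rw [MulAction.mem_stabilizer_iff] at hu ⊢
  rw [mul_smul, mul_smul, inv_smul_smul, hu]

section Tree

variable [TopologicalSpace A] [IsTopologicalGroup A]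

/-- A locally primitive Burger–Mozes action on a locally finite tree. -/
structure IsPrimitiveTreeAction (Γ : SerreGraph V E) (A : Type w) [Group A] [MulAction A V]
    [MulAction A E] [TopologicalSpace A] : Prop where
  isConnected : Γ.IsConnected
  isForest : Γ.IsForest
  isLocallyFinite : Γ.IsLocallyFinite
  isGraphAction : Γ.IsGraphAction A
  isBurgerMozes : IsBurgerMozesAction A (V ⊕ E)
  isStarTransitive : ∀ z, Γ.IsStarTransitive (⊤ : Subgroup A) z
  isMaximal : HasMaximalEdgeStabilizers Γ A

namespace IsPrimitiveTreeAction

theorem minimalPart_vertex (hT : IsPrimitiveTreeAction Γ A) (z : V) :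
    Γ.IsStarTransitive (minimalPart (MulAction.stabilizer A z)) z ∨
      ∀ k ∈ minimalPart (MulAction.stabilizer A z), ∀ f, Γ.o f = z → k • f = f :=
  hT.isMaximal.isStarTransitive_or hT.isGraphAction hT.isStarTransitive (minimalPart_le _)
    (hT.isBurgerMozes.isConjInvariant_minimalPart (isConjInvariant_stabilizer z))

/-- A discrete normal subgroup acts freely on the vertices. -/
theorem eq_one_of_smul_vertex (hT : IsPrimitiveTreeAction Γ A) {D : Subgroup A} (hD : D.Normal)
    (hd : HasTrivialFixer (V ⊕ E) D) (e : E) {d : A} (hdD : d ∈ D) (hde : d • Γ.o e = Γ.o e) :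
    d = 1 := by
  have hfix : ∀ e : E, ∀ d ∈ D, d • Γ.o e = Γ.o e → ∀ f, Γ.o f = Γ.o e → d • f = f := by
    intro e d hdD hde
    -- Transitivity on a star would make `D` cofinite, contrary to discreteness; so a vertex
    -- stabilizer in `D` fixes the star, and then everything.
    rcases hT.isMaximal.isStarTransitive_or hT.isGraphAction hT.isStarTransitive
      (z := Γ.o e) (K := D ⊓ MulAction.stabilizer A (Γ.o e)) inf_le_right
      (fun g hg n hn => ⟨hD.conj_mem n hn.1 g, isConjInvariant_stabilizer _ g hg n hn.2⟩)
      with h | h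
    · exfalso
      refine hT.isBurgerMozes.not_hasTrivialFixer_of_isFinGenCofinite hD
        (hT.isConnected.isFinGenCofinite_of_isStarTransitive hT.isLocallyFinite hT.isGraphAction
          hT.isStarTransitive hD (e₀ := Γ.bar e) ?_) hd
      rw [Γ.t_bar]
      intro f f' hf hf'
      obtain ⟨n, hn, h'⟩ := h f f' hf hf'
      exact ⟨n, hn.1, h'⟩
    · exact h d ⟨hdD, hde⟩
  have h := hT.isConnected.smul_eq_of_fixes_star hT.isGraphAction (n := d)
    (fun e f hef hne => hfix e d hdD (smul_eq_of_smul_edge hT.isGraphAction rfl rfl hne) f hef.symm)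
    (hfix e d hdD hde e rfl)
  refine hT.isBurgerMozes.faithful d ?_
  rintro (v | f)
  · rw [Sum.smul_inl, h.1]
  · rw [Sum.smul_inr, h.2]

/-- The edge stabilizers in the minimal subgroups cannot act trivially on both adjacent stars. -/
theorem not_fixes_stars (hT : IsPrimitiveTreeAction Γ A) (e : E)
    (h1 : ∀ M, Minimal (IsAdmissible A) M → ∀ m ∈ M, m • e = e →
      ∀ f, Γ.o f = Γ.o e → m • f = f)
    (h2 : ∀ M, Minimal (IsAdmissible A) M → ∀ m ∈ M, m • e = e →
      ∀ f, Γ.o f = Γ.t e → m • f = f) : False := by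
  have hA := hT.isGraphAction
  have htransport : ∀ e' : E, (∀ M, Minimal (IsAdmissible A) M → ∀ m ∈ M, m • e' = e' →
      ∀ f, Γ.o f = Γ.o e' → m • f = f) → ∀ a : A, ∀ M, Minimal (IsAdmissible A) M → ∀ m ∈ M,
      m • a • e' = a • e' → ∀ f, Γ.o f = Γ.o (a • e') → m • f = f := by
    intro e' he' a M hM m hm hme f hf
    have := he' _ (hT.isBurgerMozes.minimal_conj_smul hM a⁻¹) (a⁻¹ * m * a)
      (IsBurgerMozesAction.mem_conj_iff.2 (by simpa [mul_assoc] using hm))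
      (by rw [mul_smul, mul_smul, hme, inv_smul_smul]) (a⁻¹ • f)
      (by rw [hA.o_smul, hf, hA.o_smul, inv_smul_smul])
    rwa [mul_smul, mul_smul, smul_inv_smul, smul_left_cancel_iff] at this
  -- The action is transitive on edges up to reversal and permutes the minimal subgroups, so the
  -- hypotheses at the two ends of `e` spread to every edge.
  have hall : ∀ f : E, ∀ M, Minimal (IsAdmissible A) M → ∀ m ∈ M, m • f = f →
      ∀ f', Γ.o f' = Γ.o f → m • f' = f' := by
    intro f
    obtain ⟨a, rfl | rfl⟩ := hT.isConnected.exists_smul_edge hA hT.isStarTransitive e f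
    · exact htransport e h1 a
    · refine htransport (Γ.bar e) (fun M hM m hm hme f hf => h2 M hM m hm ?_ f ?_) a
      · rw [← Γ.bar_bar e, ← hA.bar_smul, hme]
      · rw [hf, Γ.o_bar]
  obtain ⟨M, hM⟩ := hT.isBurgerMozes.exists_minimal
  refine hM.1.not_hasTrivialFixer hT.isBurgerMozes
    ⟨{Sum.inr e}, Set.finite_singleton _, fun m hm hfix => hT.isBurgerMozes.faithful m ?_⟩
  have h := hT.isConnected.smul_eq_of_fixes_star hA (n := m)
    (fun e f hef hne => hall e M hM m hm hne f hef.symm) (Sum.inr_injective (hfix _ rfl))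
  rintro (v | f)
  · rw [Sum.smul_inl, h.1]
  · rw [Sum.smul_inr, h.2]

/-- A group generated by vertex parts, with cofinite support and compact vertex stabilizer,
contains the residual. -/
theorem residual_le_of_isCompact (hT : IsPrimitiveTreeAction Γ A) {R : Subgroup A} {S : Set V}
    {y : V}
    (hR : R ≤ ⨆ z : V, minimalPart (MulAction.stabilizer A z))
    (hRS : ∀ v, ∃ r ∈ R, ∃ s ∈ S, r • s = v)
    (hSR : ∀ s ∈ S, minimalPart (MulAction.stabilizer A s) ≤ R)
    (hcpt : IsCompact ((R ⊓ MulAction.stabilizer A y : Subgroup A) : Set A)) :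
    cocompactResidual A ≤ sSup {M | Minimal (IsAdmissible A) M} := by
  have hBM := hT.isBurgerMozes
  have := hBM.t2Space
  have hRle : ∀ z : V, minimalPart (MulAction.stabilizer A z) ≤ R := by
    intro z n hn
    obtain ⟨r, hr, s, hs, rfl⟩ := hRS z
    have h1 : r⁻¹ * n * r⁻¹⁻¹ ∈ minimalPart (MulAction.stabilizer A s) :=
      hBM.conj_mem_minimalPart (fun u hu => by
        have := conj_mem_stabilizer r⁻¹ (r • s) u hu
        rwa [inv_smul_smul] at this) hn
    have := mul_mem (mul_mem hr (hSR s hs h1)) (inv_mem hr)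
    simpa [mul_assoc] using this
  -- Thus `R` is the join of all vertex parts, a description invariant under conjugation.
  obtain rfl := le_antisymm hR (iSup_le hRle)
  have hnorm : (⨆ z : V, minimalPart (MulAction.stabilizer A z)).Normal := by
    refine ⟨fun n hn a => ?_⟩
    have hle : (⨆ z : V, minimalPart (MulAction.stabilizer A z)) ≤
        (⨆ z : V, minimalPart (MulAction.stabilizer A z)).comap (MulAut.conj a).toMonoidHom :=
      iSup_le fun z n hn => (le_iSup (fun z : V => minimalPart (MulAction.stabilizer A z)) (a • z))
        (hBM.conj_mem_minimalPart (conj_mem_stabilizer a z) hn)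
    exact hle hn
  have hstab : (MulAction.stabilizer A (Sum.inl y : V ⊕ E)) = MulAction.stabilizer A y := by
    ext g
    exact Sum.inl_injective.eq_iff
  have hcl := Subgroup.isClosed_of_isClosed_inf
    (hstab ▸ hBM.isOpen_stabilizer (Sum.inl y)) hcpt.isClosed
  obtain ⟨M, hM⟩ := hBM.exists_minimal
  refine (hBM.cocompactResidual_le hnorm hcl fun hd => ?_).trans
    (iSup_le fun z => minimalPart_le_sSup _)
  -- `R` contains an open subgroup of the non-discrete group `M`.
  obtain ⟨F, hF, h⟩ := hd.mono ((inf_le_minimalPart hM).trans (hRle y))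
  refine hM.1.not_hasTrivialFixer hBM ⟨insert (Sum.inl y) F, hF.insert _, fun g hg hfix => ?_⟩
  exact h g ⟨hg, Sum.inl_injective (hfix _ (Set.mem_insert _ _))⟩
    fun x hx => hfix x (Or.inr hx)

theorem isCompact_vertexPart (hT : IsPrimitiveTreeAction Γ A) (z : V) :
    IsCompact (minimalPart (MulAction.stabilizer A z) : Set A) := by
  refine hT.isBurgerMozes.isCompact_minimalPart ?_
  convert hT.isBurgerMozes.isCompact_stabilizer (Sum.inl z) using 1
  ext g
  exact Sum.inl_injective.eq_iff.symm

theorem isClosed_edgeStabilizer (hT : IsPrimitiveTreeAction Γ A) (e : E) :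
    IsClosed (MulAction.stabilizer A e : Set A) := by
  convert hT.isBurgerMozes.isClosed_stabilizer (Sum.inr e) using 1
  ext g
  exact Sum.inr_injective.eq_iff.symm

/-- The residual is generated by the minimal subgroups when these are locally transitive at both
ends of an edge. -/
theorem residual_le_of_isStarTransitive (hT : IsPrimitiveTreeAction Γ A) (e : E)
    (hy : Γ.IsStarTransitive (minimalPart (MulAction.stabilizer A (Γ.o e))) (Γ.o e))
    (hx : Γ.IsStarTransitive (minimalPart (MulAction.stabilizer A (Γ.t e))) (Γ.t e)) :
    cocompactResidual A ≤ sSup {M | Minimal (IsAdmissible A) M} := by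
  have hA := hT.isGraphAction
  have hBM := hT.isBurgerMozes
  set Py := minimalPart (MulAction.stabilizer A (Γ.o e)) with hPy
  set Px := minimalPart (MulAction.stabilizer A (Γ.t e)) with hPx
  have hyinv : IsConjInvariant (MulAction.stabilizer A (Γ.o e)) Py :=
    hBM.isConjInvariant_minimalPart (isConjInvariant_stabilizer _)
  have hxinv : IsConjInvariant (MulAction.stabilizer A (Γ.t e)) Px :=
    hBM.isConjInvariant_minimalPart (isConjInvariant_stabilizer _)
  have hyinv' : IsConjInvariant (Px ⊓ MulAction.stabilizer A e) Py := fun g hg =>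
    hyinv g (hA.stabilizer_le_o e hg.2)
  have hxinv' : IsConjInvariant (Py ⊓ MulAction.stabilizer A e) Px := fun g hg =>
    hxinv g (hA.stabilizer_le_t e hg.2)
  -- Each vertex part is enlarged by the edge stabilizer in the other one, so that `C` and `B` have
  -- the same intersection with the stabilizer of `e` and can be amalgamated along it.
  set C := Py ⊔ (Px ⊓ MulAction.stabilizer A e) with hC
  set B := Px ⊔ (Py ⊓ MulAction.stabilizer A e) with hB
  have hCy : C ≤ MulAction.stabilizer A (Γ.o e) :=
    sup_le (minimalPart_le _) (inf_le_right.trans (hA.stabilizer_le_o e))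
  have hBx : B ≤ MulAction.stabilizer A (Γ.t e) :=
    sup_le (minimalPart_le _) (inf_le_right.trans (hA.stabilizer_le_t e))
  have hCcpt : IsCompact (C : Set A) := Subgroup.isCompact_sup hyinv' (hT.isCompact_vertexPart _)
    ((hT.isCompact_vertexPart _).inter_right (hT.isClosed_edgeStabilizer e))
  have hglue : ∀ g ∈ (C ⊔ ⨆ _ : Unit, B : Subgroup A), g • Γ.o e = Γ.o e → g ∈ C := by
    intro g hg hgy
    refine hT.isForest.mem_of_mem_sup hA (I := Unit) (e := fun _ => e) (fun _ => rfl)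
      (fun c hc => hCy hc) (fun _ b hb => hBx hb) ?_ ?_ (fun _ _ _ _ _ => rfl) hg hgy
    · intro _ b hb hbe
      obtain ⟨k, hk, l, hl, rfl⟩ := Subgroup.exists_mul_of_mem_sup hxinv' hb
      refine mul_mem (Subgroup.mem_sup_right ⟨hk, ?_⟩) (Subgroup.mem_sup_left hl.1)
      exact (Subgroup.mul_mem_cancel_right _ hl.2).1 hbe
    · intro _ c hc hce
      obtain ⟨k, hk, l, hl, rfl⟩ := Subgroup.exists_mul_of_mem_sup hyinv' hc
      refine mul_mem (Subgroup.mem_sup_right ⟨hk, ?_⟩) (Subgroup.mem_sup_left hl.1)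
      exact (Subgroup.mul_mem_cancel_right _ hl.2).1 hce
  rw [iSup_const] at hglue
  have hPyR : Py ≤ C ⊔ B := le_sup_left.trans le_sup_left
  have hPxR : Px ≤ C ⊔ B := le_sup_left.trans le_sup_right
  refine hT.residual_le_of_isCompact (R := C ⊔ B) (S := {Γ.o e, Γ.t e}) (y := Γ.o e)
    ?_ (hT.isConnected.exists_smul_eq hA ⟨_, Or.inl rfl⟩ ?_) ?_ ?_
  · have h1 : Py ≤ ⨆ z : V, minimalPart (MulAction.stabilizer A z) :=
      le_iSup (fun z : V => minimalPart (MulAction.stabilizer A z)) _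
    have h2 : Px ≤ ⨆ z : V, minimalPart (MulAction.stabilizer A z) :=
      le_iSup (fun z : V => minimalPart (MulAction.stabilizer A z)) _
    exact sup_le (sup_le h1 (inf_le_left.trans h2)) (sup_le h2 (inf_le_left.trans h1))
  · rintro s (rfl | rfl) f hf
    · obtain ⟨k, hk, rfl⟩ := hy e f rfl hf
      exact ⟨k, hPyR hk, Γ.t e, Or.inr rfl, (hA.t_smul _ _).symm⟩
    · obtain ⟨k, hk, rfl⟩ := hx (Γ.bar e) f (Γ.o_bar e) hf
      exact ⟨k, hPxR hk, Γ.o e, Or.inl rfl, by rw [hA.t_smul, Γ.t_bar]⟩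
  · rintro s (rfl | rfl)
    · exact hPyR
    · exact hPxR
  · have : (C ⊔ B) ⊓ MulAction.stabilizer A (Γ.o e) = C :=
      le_antisymm (fun g hg => hglue g hg.1 hg.2) (le_inf le_sup_left hCy)
    rw [this]
    exact hCcpt

/-- If the vertex part at one end of an edge acts trivially on its star, it contains the edge
stabilizer in the vertex part at the other end. -/
theorem mem_minimalPart_of_smul_edge (hT : IsPrimitiveTreeAction Γ A) (e : E)
    (hy : ∀ k ∈ minimalPart (MulAction.stabilizer A (Γ.o e)), ∀ f, Γ.o f = Γ.o e → k • f = f)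
    {k : A} (hk : k ∈ minimalPart (MulAction.stabilizer A (Γ.t e))) (hke : k • e = e) :
    k ∈ minimalPart (MulAction.stabilizer A (Γ.o e)) := by
  classical
  have hA := hT.isGraphAction
  have hBM := hT.isBurgerMozes
  refine minimalPart_mono (hA.stabilizer_le_o e) ?_
  set P := minimalPart (MulAction.stabilizer A e) with hP
  have hbar : ∀ a : A, a • Γ.bar e = Γ.bar e ↔ a • e = e := fun a =>
    ⟨fun h => by rw [← Γ.bar_bar e, ← hA.bar_smul, h], fun h => by rw [← hA.bar_smul, h]⟩
  -- The normalizer of `P` in the stabilizer of `Γ.t e`.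
  let N : Subgroup A :=
    { carrier := {n | n • Γ.t e = Γ.t e ∧ (∀ p ∈ P, n * p * n⁻¹ ∈ P) ∧ ∀ p ∈ P, n⁻¹ * p * n ∈ P}
      one_mem' := by simp
      mul_mem' := fun {g g'} hg hg' => by
        refine ⟨by rw [mul_smul, hg'.1, hg.1], fun p hp => ?_, fun p hp => ?_⟩
        · simpa [mul_assoc] using hg.2.1 _ (hg'.2.1 p hp)
        · simpa [mul_assoc] using hg'.2.2 _ (hg.2.2 p hp)
      inv_mem' := fun {g} hg =>
        ⟨inv_smul_eq_iff.2 hg.1.symm, by simpa using hg.2.2, by simpa using hg.2.1⟩ }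
  have hPinv : IsConjInvariant (MulAction.stabilizer A e) P :=
    hBM.isConjInvariant_minimalPart (isConjInvariant_stabilizer _)
  have hN1 : MulAction.stabilizer A (Γ.bar e) ≤ N := by
    intro n hn
    have hn' : n ∈ MulAction.stabilizer A e := (hbar n).1 hn
    exact ⟨hA.stabilizer_le_t e hn', hPinv n hn', by simpa using hPinv _ (inv_mem hn')⟩
  have hN2 : N ≤ MulAction.stabilizer A (Γ.o (Γ.bar e)) := by
    intro n hn
    rw [Γ.o_bar]
    exact hn.1
  -- Otherwise `N` is transitive on the star at `Γ.t e`, so `P`, which fixes `e`, fixes that star;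
  -- by `hy` it also fixes the star at `Γ.o e`, which `not_fixes_stars` excludes.
  have hNe : ∀ n ∈ N, n • e = e := by
    rcases hT.isMaximal (Γ.bar e) N hN1 hN2 with h | h
    · exact fun n hn => (hbar n).1 (h hn)
    · exfalso
      refine hT.not_fixes_stars e (fun M hM m hm hme f hf => ?_) (fun M hM m hm hme f hf => ?_)
      · exact hy m (inf_le_minimalPart hM ⟨hm, hA.stabilizer_le_o e hme⟩) f hf
      · obtain ⟨n, hn, rfl⟩ := h f (by rw [hf, Γ.o_bar])
        have hmP : m ∈ P := inf_le_minimalPart hM ⟨hm, hme⟩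
        have := (hbar _).2 (minimalPart_le _ (hn.2.2 m hmP))
        rwa [mul_smul, mul_smul, inv_smul_eq_iff] at this
  -- Commutators lie in the discrete quasi-center and fix a vertex, and that group acts freely on
  -- vertices: here commutation is exact.
  have hcomm : ∀ M M', Minimal (IsAdmissible A) M → Minimal (IsAdmissible A) M' → M ≠ M' →
      ∀ m ∈ M ⊓ MulAction.stabilizer A (Γ.t e), ∀ m' ∈ M' ⊓ MulAction.stabilizer A (Γ.t e),
      Commute m m' := by
    intro M M' hM hM' hne m hm m' hm'
    have h1 := IsBurgerMozesAction.commutator_mem_of_minimal hM hM' hne hm.1 hm'.1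
    have h2 : m * m' * m⁻¹ * m'⁻¹ ∈ MulAction.stabilizer A (Γ.t e) :=
      mul_mem (mul_mem (mul_mem hm.2 hm'.2) (inv_mem hm.2)) (inv_mem hm'.2)
    have h3 := hT.eq_one_of_smul_vertex hBM.normal_residualQuasiCenter
      hBM.hasTrivialFixer_residualQuasiCenter (Γ.bar e) h1 (by rw [Γ.o_bar]; exact h2)
    rwa [← commutatorElement_def, commutatorElement_eq_one_iff_commute] at h3
  have key : ∀ s : Finset (Subgroup A), (∀ M ∈ s, Minimal (IsAdmissible A) M) →
      ∀ k ∈ (⨆ M ∈ s, M ⊓ MulAction.stabilizer A (Γ.t e) : Subgroup A), k • e = e → k ∈ P := by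
    intro s
    induction s using Finset.induction_on with
    | empty =>
      intro _ k hk _
      simp only [Finset.notMem_empty, iSup_false, iSup_bot, Subgroup.mem_bot] at hk
      rw [hk]
      exact one_mem _
    | insert M s hMs ih =>
      intro hs k hk hke
      rw [Finset.iSup_insert] at hk
      have hM := hs M (Finset.mem_insert_self _ _)
      have hs' : ∀ M ∈ s, Minimal (IsAdmissible A) M := fun M h =>
        hs M (Finset.mem_insert_of_mem h)
      have hcs : ∀ m ∈ M ⊓ MulAction.stabilizer A (Γ.t e),
          ∀ l ∈ (⨆ M ∈ s, M ⊓ MulAction.stabilizer A (Γ.t e) : Subgroup A), Commute m l := by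
        intro m hm l hl
        have hle : (⨆ M ∈ s, M ⊓ MulAction.stabilizer A (Γ.t e) : Subgroup A) ≤
            Subgroup.centralizer {m} := iSup₂_le fun M' hM' m' hm' =>
          Subgroup.mem_centralizer_singleton_iff.2
            (hcomm M M' hM (hs' M' hM') (fun h => hMs (h ▸ hM')) m hm m' hm').symm.eq
        exact (Subgroup.mem_centralizer_singleton_iff.1 (hle hl)).symm
      obtain ⟨a, ha, l, hl, rfl⟩ := Subgroup.exists_mul_of_mem_sup
        (fun l hl m hm => by rwa [← (hcs m hm l hl).eq, mul_inv_cancel_right]) hk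
      have hlG : l ∈ cocompactResidual A := (iSup₂_le fun M hM =>
        inf_le_left.trans (hs' M hM).1.le_residual :
          (⨆ M ∈ s, M ⊓ MulAction.stabilizer A (Γ.t e)) ≤ cocompactResidual A) hl
      -- On the `M`-part of `P`, conjugation by `b` agrees with conjugation by `b * l'`, which fixes
      -- `e`; on the other parts it is trivial. Hence the component `a` of an element fixing `e`
      -- normalizes `P`, and by `hNe` fixes `e` itself.
      have hconj : ∀ b ∈ M ⊓ MulAction.stabilizer A (Γ.t e), ∀ l',
          l' ∈ (⨆ M ∈ s, M ⊓ MulAction.stabilizer A (Γ.t e) : Subgroup A) → (b * l') • e = e →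
          ∀ p ∈ P, b * p * b⁻¹ ∈ P := by
        intro b hb l' hl' hble
        have hle : P ≤ P.comap (MulAut.conj b).toMonoidHom := by
          refine iSup₂_le fun M' hM' m hm => ?_
          change b * m * b⁻¹ ∈ P
          have hmt : m ∈ M' ⊓ MulAction.stabilizer A (Γ.t e) := ⟨hm.1, hA.stabilizer_le_t e hm.2⟩
          by_cases hMM : M = M'
          · subst hMM
            have h1 := hPinv (b * l') hble m (inf_le_minimalPart hM hm)
            have h2 : b * l' * m * (b * l')⁻¹ = b * m * b⁻¹ := by
              calc b * l' * m * (b * l')⁻¹ = b * (l' * m) * l'⁻¹ * b⁻¹ := by group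
                _ = b * m * b⁻¹ := by rw [← (hcs m hmt l' hl').eq]; group
            rwa [h2] at h1
          · rw [(hcomm M M' hM hM' hMM b hb m hmt).eq, mul_inv_cancel_right]
            exact inf_le_minimalPart hM' hm
        exact fun p hp => hle hp
      have haN : a ∈ N := by
        refine ⟨ha.2, hconj a ha l hl hke, ?_⟩
        have := hconj a⁻¹ (inv_mem ha) l⁻¹ (inv_mem hl) (by
          rw [← mul_inv_rev, ← (hcs a ha l hl).eq]
          exact inv_smul_eq_iff.2 hke.symm)
        simpa using this
      have hae := hNe a haN
      have hle : l • e = e := by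
        rwa [mul_smul, ← eq_inv_smul_iff, inv_smul_eq_iff.2 hae.symm] at hke
      exact mul_mem (inf_le_minimalPart hM ⟨ha.1, hae⟩) (ih hs' l hl hle)
  exact key hBM.finite_minimal.toFinset (by simp) k (by simpa [minimalPart] using hk) hke

/-- The residual is generated by the minimal subgroups when these are locally trivial at some
vertex. -/
theorem residual_le_of_fixes_star (hT : IsPrimitiveTreeAction Γ A) (e : E)
    (hy : ∀ k ∈ minimalPart (MulAction.stabilizer A (Γ.o e)), ∀ f, Γ.o f = Γ.o e → k • f = f) :
    cocompactResidual A ≤ sSup {M | Minimal (IsAdmissible A) M} := by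
  have hA := hT.isGraphAction
  set Py := minimalPart (MulAction.stabilizer A (Γ.o e)) with hPy
  -- All neighbouring vertex parts are glued along `Py`, which they contain and which contains their
  -- edge stabilizers. As `Py` fixes every edge of the star, these edges lie in distinct
  -- `Py`-orbits.
  set B : Γ.star (Γ.o e) → Subgroup A :=
    fun f => minimalPart (MulAction.stabilizer A (Γ.t (f : E))) with hB
  have hB1 : ∀ f : Γ.star (Γ.o e), ∀ b ∈ B f, b • (f : E) = f → b ∈ Py := by
    rintro ⟨f, hf⟩ b hb hbf
    have hf : Γ.o f = Γ.o e := hf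
    have := hT.mem_minimalPart_of_smul_edge f (by rw [hf]; exact hy) hb hbf
    rwa [hf] at this
  have hB2 : ∀ f : Γ.star (Γ.o e), Py ≤ B f := by
    rintro ⟨f, hf⟩
    refine iSup₂_le fun M hM m hm => inf_le_minimalPart hM ⟨hm.1, ?_⟩
    exact hA.stabilizer_le_t f (hy m (inf_le_minimalPart hM hm) f hf)
  have : Nonempty (Γ.star (Γ.o e)) := ⟨⟨e, rfl⟩⟩
  have hglue : ∀ g ∈ (Py ⊔ ⨆ f, B f : Subgroup A), g • Γ.o e = Γ.o e → g ∈ Py := by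
    intro g hg hgy
    refine hT.isForest.mem_of_mem_sup hA (e := fun f : Γ.star (Γ.o e) => (f : E))
      (fun f => f.2) (fun c hc => minimalPart_le _ hc) (fun f b hb => minimalPart_le _ hb)
      hB1 (fun f c hc _ => hB2 f hc) (fun f f' c hc h => ?_) hg hgy
    rw [hy c hc _ f'.2] at h
    exact (Subtype.ext h).symm
  have hBR : ∀ f, B f ≤ Py ⊔ ⨆ f, B f := fun f => (le_iSup B f).trans le_sup_right
  -- The vertex parts at both ends of an edge cannot act trivially on their stars, by
  -- `not_fixes_stars`.
  have hBtrans : ∀ f : Γ.star (Γ.o e), Γ.IsStarTransitive (B f) (Γ.t (f : E)) := by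
    intro f
    refine (hT.minimalPart_vertex _).resolve_right fun h => ?_
    refine hT.not_fixes_stars (f : E) (fun M hM m hm hmf f' hf' => ?_)
      (fun M hM m hm hmf f' hf' => ?_)
    · have hfo : Γ.o (f : E) = Γ.o e := f.2
      refine hy m (inf_le_minimalPart hM ⟨hm, ?_⟩) f' (hf'.trans hfo)
      rw [← hfo]
      exact hA.stabilizer_le_o _ hmf
    · exact h m (inf_le_minimalPart hM ⟨hm, hA.stabilizer_le_t _ hmf⟩) f' hf'
  refine hT.residual_le_of_isCompact (R := Py ⊔ ⨆ f, B f)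
    (S := insert (Γ.o e) (Γ.t '' Γ.star (Γ.o e))) (y := Γ.o e)
    ?_ (hT.isConnected.exists_smul_eq hA ⟨_, Or.inl rfl⟩ ?_) ?_ ?_
  · exact sup_le (le_iSup (fun z : V => minimalPart (MulAction.stabilizer A z)) _)
      (iSup_le fun f => le_iSup (fun z : V => minimalPart (MulAction.stabilizer A z)) _)
  · rintro s (rfl | ⟨f, hf, rfl⟩) f' hf'
    · exact ⟨1, one_mem _, Γ.t f', Or.inr ⟨f', hf', rfl⟩, one_smul _ _⟩
    · obtain ⟨k, hk, rfl⟩ := hBtrans ⟨f, hf⟩ (Γ.bar f) f' (Γ.o_bar f) hf'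
      exact ⟨k, hBR _ hk, Γ.o e, Or.inl rfl, by rw [hA.t_smul, Γ.t_bar, hf]⟩
  · rintro s (rfl | ⟨f, hf, rfl⟩)
    · exact le_sup_left
    · exact hBR ⟨f, hf⟩
  · have : (Py ⊔ ⨆ f, B f) ⊓ MulAction.stabilizer A (Γ.o e) = Py :=
      le_antisymm (fun g hg => hglue g hg.1 hg.2) (le_inf le_sup_left (minimalPart_le _))
    rw [this]
    exact hT.isCompact_vertexPart _

theorem residual_le (hT : IsPrimitiveTreeAction Γ A) (e : E) :
    cocompactResidual A ≤ sSup {M | Minimal (IsAdmissible A) M} := by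
  rcases hT.minimalPart_vertex (Γ.o e) with h1 | h1
  · rcases hT.minimalPart_vertex (Γ.t e) with h2 | h2
    · exact hT.residual_le_of_isStarTransitive e h1 h2
    · exact hT.residual_le_of_fixes_star (Γ.bar e) (by rwa [Γ.o_bar])
  · exact hT.residual_le_of_fixes_star e h1

end IsPrimitiveTreeAction

end Tree

end SerreGraph

/-! ### The main theorem. -/

theorem theorem2 {V : Type u} {E : Type v} (Γ : SerreGraph V E)
    (hfin : Γ.IsLocallyFinite) (hconn : Γ.IsConnected)
    (H : Subgroup Γ.Aut) (hclosed : IsClosed (H : Set Γ.Aut))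
    (hnd : ¬ DiscreteTopology H) (hsemi : SerreGraph.IsLocallySemiprimitive H) :
    Minimal IsClosedNormalCocompact (cocompactResidual H) ∧
    (Maximal (fun N : Subgroup H => N.Normal ∧ DiscreteTopology N) (quasiCenter H) ∧
      ¬ CompactSpace (H ⧸ quasiCenter H)) ∧
    (quasiCenter (cocompactResidual H) = (quasiCenter H).subgroupOf (cocompactResidual H) ∧
      (minimalClosedNormalSubgroups (BMSubquotient H)).Nonempty ∧
      (minimalClosedNormalSubgroups (BMSubquotient H)).Finite ∧
      (∀ M ∈ minimalClosedNormalSubgroups (BMSubquotient H),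
        ∀ M' ∈ minimalClosedNormalSubgroups (BMSubquotient H),
          BMSubquotient.AreConjugate M M') ∧
      ∀ M ∈ minimalClosedNormalSubgroups (BMSubquotient H), IsTopologicallySimple M) ∧
    (Γ.IsTree → SerreGraph.IsLocallyPrimitive H →
      IsDirectProductOfTopologicallySimple (BMSubquotient H)) := by
  have hP := (SerreGraph.isProfiniteAction_aut hfin hconn).subgroup hclosed
  have hA : Γ.IsGraphAction H := SerreGraph.isGraphAction_aut.subgroup H
  have htrans : ∀ z, Γ.IsStarTransitive (⊤ : Subgroup H) z := fun z =>
    SerreGraph.isStarTransitive_top (hsemi z).1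
  have hBM : IsBurgerMozesAction H (V ⊕ E) :=
    hconn.isBurgerMozesAction hfin hA hP hnd htrans hsemi.isStarTransitive_or
  refine ⟨hBM.minimal_cocompactResidual,
    ⟨hBM.maximal_quasiCenter, hBM.not_compactSpace_quasiCenter⟩,
    ⟨hBM.quasiCenter_cocompactResidual, hBM.minimalClosedNormalSubgroups_nonempty,
      hBM.minimalClosedNormalSubgroups_finite, fun M hM M' hM' => hBM.areConjugate_of_minimal hM hM',
      fun M hM => hBM.isTopologicallySimple_of_minimal hM⟩, fun htree hprim => ?_⟩
  have hT : SerreGraph.IsPrimitiveTreeAction Γ H :=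
    ⟨htree.1, htree.2, hfin, hA, hBM, htrans, hprim.le_stabilizer_or⟩
  obtain ⟨e⟩ := hconn.nonempty_edge hP hBM.not_discrete
  exact hBM.isDirectProductOfTopologicallySimple (hT.residual_le e)
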